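/- Fix a set $\Sigma$ of letters and variables $V=\{v_1,v_2,\dots\}$. A finite chart is $C=(Q,s,D,E)$ with $Q$ a finite set of states, $s\in Q$, and finite relations $D\subseteq Q\times\Sigma\times Q$ (transitions) and $E\subseteq Q\times V$ (outputs); write $D(q)=\{(a,q'):(q,a,q')\in D\}$ and $E(q)=\{v:(q,v)\in E\}$. A bisimulation between two charts is a relation $R$ between their states such that $(q,r)\in R$ implies $E(q)=E(r)$, every $q\xrightarrow{a}q'$ is matched by some $r\xrightarrow{a}r'$ with $(q',r')\in R$, and symmetrically; charts are bisimilar if some bisimulation relates their start states. Regular behaviours are finite charts modulo bisimilarity. A variable is live in a chart if it is output by a state reachable from the start state; $\Omega(n)$ is the set of regular behaviours whose live variables lie in $\{v_1,\dots,v_n\}$. On regular behaviours one has (via representatives): the variable $v$, given by one state with the single output $v$ and no transitions; for distinct $x_1,\dots,x_n\in V$, the substitution $C[C_1,\dots,C_n/x_1,\dots,x_n]$ on the disjoint union of the state sets, with the start state of $C$, in which the states of each $C_i$ are unchanged and each state $q$ of $C$ loses the outputs $x_1,\dots,x_n$ and, whenever $x_i\in E(q)$, acquires the transitions and outputs of the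 start state of $C_i$; and the recursion $\mu v.C$, with the same states and start state $s$, in which every $q$ with $v\in E(q)$ acquires the transitions $D(s)$ and has outputs $(E(q)\cup E(s))\setminus\{v\}$. Let $\mathsf{RegBeh}$ have the natural numbers as objects, $n$-tuples of elements of $\Omega(m)$ as morphisms $n\to m$, identities $\mathrm{id}_n=(v_1,\dots,v_n)$, and composition (in diagrammatic order) $f;g=(f_1[\vec g/\vec v],\dots,f_m[\vec g/\vec v])$ for $f\colon m\to n$, $g\colon n\to p$, where $\vec v=(v_1,\dots,v_n)$. Let $\mathsf{inl}_{k,l}=(v_1,\dots,v_k)\colon k\to k+l$, $\mathsf{inr}_{k,l}=(v_{k+1},\dots,v_{k+l})\colon l\to k+l$, $\langle f,g\rangle=(f_1,\dots,f_k,g_1,\dots,g_l)$, let $0_n\colon 0\to n$ be the empty tuple, $\nabla_n=\langle \mathrm{id}_n,\mathrm{id}_n\rangle$, $\sigma_{m,n}=\langle\mathsf{inr}_{n,m},\mathsf{inl}_{n,m}\rangle\colon m+n\to n+m$, and, for $f\colon k\to l$ and $g\colon m\to n$, $f\oplus g=\langle f,\ g;\mathsf{inr}_{l,n}\rangle\colon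 k+m\to l+n$ (with $f_i\in\Omega(l)\subseteq\Omega(l+n)$). For $f\colon 1\to p+1$ put $f^\dagger=\mu v_{p+1}.f$, and extend $(-)^\dagger$ to all $f\colon n\to p+n$ (with $f^\dagger\colon n\to p$) by $f^\dagger=0_p$ for $n=0$ and by recursion on $n$ through the pairing identity (d) below. **Theorem.** $\mathsf{RegBeh}$ is a category with the following properties. 1. It has all finite coproducts: $0$ is initial, and $k+l$ with $\mathsf{inl}_{k,l},\mathsf{inr}_{k,l}$ is a coproduct of $k$ and $l$ with mediating morphisms $\langle f,g\rangle$. 2. $(\mathsf{RegBeh},\oplus,0)$ with symmetry $\sigma$ is a strict symmetric monoidal category, and it is co-Cartesian (the unit is initial and the tensor product is the coproduct). 3. With $(-)^\dagger$ it is a Conway theory: (a) $(f;(g\oplus\mathrm{id}_1))^\dagger=f^\dagger;g$ for $f\colon1\to p+1$, $g\colon p\to q$; (b) $(f;\langle\mathrm{id}_p\oplus0_1,g\rangle)^\dagger=f;\langle\mathrm{id}_p,(g;\langle\mathrm{id}_p\oplus0_1,f\rangle)^\dagger\rangle$ for $f,g\colon1\to p+1$; (c) $f^{\dagger\dagger}=(f;(\mathrm{id}_p\oplus\nabla_1))^\dagger$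 for $f\colon1\to p+2$; (d) $(\langle f,g\rangle;(\mathrm{id}_p\oplus\sigma_{1,n}))^\dagger=\langle f^\dagger;\langle\mathrm{id}_p,h^\dagger\rangle,h^\dagger\rangle$ for $f\colon n\to p+1+n$ and $g\colon1\to p+1+n$, where $h=g;\langle\mathrm{id}_{p+1},f^\dagger\rangle\colon 1\to p+1$. 4. Setting, for $g\colon p+n\to q+n$, $$\mathsf{Tr}^n_{p,q}(g)=\mathsf{inl}_{p,n};\bigl(g;\langle\mathsf{inl}_{q,p+n},\ \mathsf{inr}_{q+p,n}\rangle\bigr)^\dagger\colon p\to q$$ (the dagger being that of a morphism $p+n\to q+(p+n)$) makes $\mathsf{RegBeh}$ a traced symmetric monoidal category, i.e. the axioms of Joyal, Street and Verity (naturality in $p$ and $q$, sliding in $n$, vanishing, superposing, yanking) hold. -/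

import Mathlib

open CategoryTheory CategoryTheory.Limits CategoryTheory.MonoidalCategory

universe u v w

/-! ## Finite charts and bisimilarity -/

/-- A finite chart `(Q, s, D, E)` over the alphabet `A`. The set of variables is
`V = {v₁, v₂, …}`; the variable `vᵢ₊₁` is represented by the natural number `i`. -/
structure FinChart (A : Type u) where
  /-- states -/
  Q : Type
  finite_Q : Finite Q
  /-- the start node -/
  start : Q
  /-- `D q a q'` means `(q, a, q') ∈ D` -/
  D : Q → A → Q → Prop
  /-- `E q x` means `(q, x) ∈ E` -/
  E : Q → ℕ → Prop
  finite_D : {t : Q × A × Q | D t.1 t.2.1 t.2.2}.Finite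
  finite_E : {t : Q × ℕ | E t.1 t.2}.Finite

namespace FinChart

variable {A : Type u}

/-- With finitely many states, it suffices that finitely many letters occur. -/
theorem finite_trans {Q : Type} [Finite Q] {D : Q → A → Q → Prop} {S : Set A} (hS : S.Finite)
    (h : ∀ q a q', D q a q' → a ∈ S) : {t : Q × A × Q | D t.1 t.2.1 t.2.2}.Finite :=
  ((Set.finite_univ (α := Q)).prod (hS.prod (Set.finite_univ (α := Q)))).subset
    fun _ ht => ⟨trivial, h _ _ _ ht, trivial⟩

theorem finite_out {Q : Type} [Finite Q] {E : Q → ℕ → Prop} {S : Set ℕ} (hS : S.Finite)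
    (h : ∀ q x, E q x → x ∈ S) : {t : Q × ℕ | E t.1 t.2}.Finite :=
  ((Set.finite_univ (α := Q)).prod hS).subset fun _ ht => ⟨trivial, h _ _ ht⟩

/-- The letters occurring on transitions of a chart. -/
def letters (C : FinChart A) : Set A := {a | ∃ q q', C.D q a q'}

/-- The variables occurring as outputs of a chart. -/
def outputs (C : FinChart A) : Set ℕ := {x | ∃ q, C.E q x}

theorem letters_finite (C : FinChart A) : C.letters.Finite :=
  (C.finite_D.image fun t => t.2.1).subset fun a ⟨q, q', h⟩ => ⟨(q, a, q'), h, rfl⟩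

theorem outputs_finite (C : FinChart A) : C.outputs.Finite :=
  (C.finite_E.image fun t => t.2).subset fun x ⟨q, h⟩ => ⟨(q, x), h, rfl⟩

/-- The chart `({s}, s, ∅, {(s, x)})` of a variable. -/
def var (x : ℕ) : FinChart A where
  Q := Unit
  finite_Q := inferInstance
  start := ()
  D := fun _ _ _ => False
  E := fun _ y => y = x
  finite_D := finite_trans (S := ∅) Set.finite_empty fun _ _ _ h => False.elim h
  finite_E := finite_out (Set.finite_singleton x) fun _ _ h => h

/-- Transitions of a substitution. -/
def substD (C : FinChart A) {n : ℕ} (x : Fin n → ℕ) (B : Fin n → FinChart A) :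
    C.Q ⊕ (Σ i, (B i).Q) → A → C.Q ⊕ (Σ i, (B i).Q) → Prop
  | .inl q, a, .inl q' => C.D q a q'
  | .inl q, a, .inr ⟨i, r⟩ => C.E q (x i) ∧ (B i).D (B i).start a r
  | .inr _, _, .inl _ => False
  | .inr ⟨i, r⟩, a, t => ∃ r', t = .inr ⟨i, r'⟩ ∧ (B i).D r a r'

/-- Outputs of a substitution. -/
def substE (C : FinChart A) {n : ℕ} (x : Fin n → ℕ) (B : Fin n → FinChart A) :
    C.Q ⊕ (Σ i, (B i).Q) → ℕ → Prop
  | .inl q, y => (C.E q y ∧ y ∉ Set.range x) ∨ ∃ i, C.E q (x i) ∧ (B i).E (B i).start y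
  | .inr ⟨i, r⟩, y => (B i).E r y

/-- Simultaneous substitution `C[B₁, …, Bₙ / x₁, …, xₙ]` for distinct variables `xᵢ`; the state
space is the disjoint union of those of `C` and of the `Bᵢ`. -/
def subst (C : FinChart A) {n : ℕ} (x : Fin n → ℕ) (B : Fin n → FinChart A) : FinChart A where
  Q := C.Q ⊕ (Σ i, (B i).Q)
  finite_Q := by
    have := C.finite_Q
    have := fun i => (B i).finite_Q
    infer_instance
  start := .inl C.start
  D := C.substD x B
  E := C.substE x B
  finite_D := by
    have := C.finite_Q
    have := fun i => (B i).finite_Q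
    refine finite_trans (C.letters_finite.union
      (Set.finite_iUnion fun i => (B i).letters_finite)) ?_
    rintro (q | ⟨i, r⟩) a (q' | ⟨j, r'⟩) h
    · exact Or.inl ⟨_, _, h⟩
    · exact Or.inr (Set.mem_iUnion.2 ⟨j, _, _, h.2⟩)
    · exact h.elim
    · obtain ⟨r'', -, h⟩ := h
      exact Or.inr (Set.mem_iUnion.2 ⟨i, _, _, h⟩)
  finite_E := by
    have := C.finite_Q
    have := fun i => (B i).finite_Q
    refine finite_out (C.outputs_finite.union
      (Set.finite_iUnion fun i => (B i).outputs_finite)) ?_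
    rintro (q | ⟨i, r⟩) y h
    · rcases h with h | ⟨i, -, h⟩
      · exact Or.inl ⟨_, h.1⟩
      · exact Or.inr (Set.mem_iUnion.2 ⟨i, _, h⟩)
    · exact Or.inr (Set.mem_iUnion.2 ⟨i, _, h⟩)

/-- Transitions of a recursion. -/
def muD (x : ℕ) (C : FinChart A) (q : C.Q) (a : A) (q' : C.Q) : Prop :=
  C.D q a q' ∨ (C.E q x ∧ C.D C.start a q')

/-- Outputs of a recursion. -/
def muE (x : ℕ) (C : FinChart A) (q : C.Q) (y : ℕ) : Prop :=
  (C.E q y ∨ (C.E q x ∧ C.E C.start y)) ∧ y ≠ x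

/-- Recursion `μ x. C`: every state with output `x` also behaves as the start node, and the
output `x` is removed. -/
def mu (x : ℕ) (C : FinChart A) : FinChart A where
  Q := C.Q
  finite_Q := C.finite_Q
  start := C.start
  D := C.muD x
  E := C.muE x
  finite_D := by
    have := C.finite_Q
    refine finite_trans C.letters_finite ?_
    rintro q a q' (h | h)
    · exact ⟨_, _, h⟩
    · exact ⟨_, _, h.2⟩
  finite_E := by
    have := C.finite_Q
    refine finite_out C.outputs_finite ?_
    rintro q y ⟨h | h, -⟩
    · exact ⟨_, h⟩
    · exact ⟨_, h.2⟩

/-- Strong bisimulations between (the underlying precharts of) two charts. -/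
structure IsBisim (C C' : FinChart A) (R : C.Q → C'.Q → Prop) : Prop where
  out : ∀ {q r}, R q r → ∀ x, C.E q x ↔ C'.E r x
  forth : ∀ {q r}, R q r → ∀ {a q'}, C.D q a q' → ∃ r', C'.D r a r' ∧ R q' r'
  back : ∀ {q r}, R q r → ∀ {a r'}, C'.D r a r' → ∃ q', C.D q a q' ∧ R q' r'

/-- Bisimilarity of charts. -/
def Bisimilar (C C' : FinChart A) : Prop :=
  ∃ R : C.Q → C'.Q → Prop, IsBisim C C' R ∧ R C.start C'.start

theorem Bisimilar.refl (C : FinChart A) : Bisimilar C C :=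
  ⟨Eq, ⟨by rintro q _ rfl x; rfl, by rintro q _ rfl a q' h; exact ⟨_, h, rfl⟩,
    by rintro q _ rfl a q' h; exact ⟨_, h, rfl⟩⟩, rfl⟩

theorem Bisimilar.symm {C C' : FinChart A} : Bisimilar C C' → Bisimilar C' C := by
  rintro ⟨R, h, hs⟩
  exact ⟨fun r q => R q r, ⟨fun hr x => (h.out hr x).symm, fun hr => h.back hr,
    fun hr => h.forth hr⟩, hs⟩

theorem Bisimilar.trans {C₁ C₂ C₃ : FinChart A} :
    Bisimilar C₁ C₂ → Bisimilar C₂ C₃ → Bisimilar C₁ C₃ := by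
  rintro ⟨R, h, hs⟩ ⟨S, k, ks⟩
  refine ⟨fun q t => ∃ r, R q r ∧ S r t, ⟨?_, ?_, ?_⟩, _, hs, ks⟩
  · rintro q t ⟨r, hr, kr⟩ x
    exact (h.out hr x).trans (k.out kr x)
  · rintro q t ⟨r, hr, kr⟩ a q' hq
    obtain ⟨r', h1, h2⟩ := h.forth hr hq
    obtain ⟨t', h3, h4⟩ := k.forth kr h1
    exact ⟨t', h3, r', h2, h4⟩
  · rintro q t ⟨r, hr, kr⟩ a q' hq
    obtain ⟨r', h1, h2⟩ := k.back kr hq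
    obtain ⟨t', h3, h4⟩ := h.back hr h1
    exact ⟨t', h3, r', h4, h2⟩

instance setoid (A : Type u) : Setoid (FinChart A) :=
  ⟨Bisimilar, Bisimilar.refl, Bisimilar.symm, Bisimilar.trans⟩

/-- States reachable from the start node. -/
inductive Reach (C : FinChart A) : C.Q → Prop
  | start : Reach C C.start
  | step {q a q'} : Reach C q → C.D q a q' → Reach C q'

/-- `x` is live in `C` if some reachable state outputs `x`. -/
def Live (C : FinChart A) (x : ℕ) : Prop := ∃ q, C.Reach q ∧ C.E q x

theorem Bisimilar.live_imp {C C' : FinChart A} (h : Bisimilar C C') {x : ℕ} (hx : C.Live x) :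
    C'.Live x := by
  obtain ⟨R, h, hs⟩ := h
  have key : ∀ q, C.Reach q → ∃ r, C'.Reach r ∧ R q r := by
    intro q hq
    induction hq with
    | start => exact ⟨_, .start, hs⟩
    | step _ hd ih =>
      obtain ⟨r, hr, hR⟩ := ih
      obtain ⟨r', h1, h2⟩ := h.forth hR hd
      exact ⟨r', .step hr h1, h2⟩
  obtain ⟨q, hq, hx⟩ := hx
  obtain ⟨r, hr, hR⟩ := key q hq
  exact ⟨r, hr, (h.out hR x).1 hx⟩

theorem Bisimilar.live_iff {C C' : FinChart A} (h : Bisimilar C C') (x : ℕ) :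
    C.Live x ↔ C'.Live x := ⟨h.live_imp, h.symm.live_imp⟩

theorem Bisimilar.mu {C C' : FinChart A} (x : ℕ) (h : Bisimilar C C') :
    Bisimilar (C.mu x) (C'.mu x) := by
  obtain ⟨R, h, hs⟩ := h
  refine ⟨R, ⟨?_, ?_, ?_⟩, hs⟩
  · intro q r hr y
    simp only [FinChart.mu, muE, h.out hr, h.out hs]
  · rintro q r hr a q' (hd | ⟨he, hd⟩)
    · obtain ⟨r', h1, h2⟩ := h.forth hr hd
      exact ⟨r', .inl h1, h2⟩
    · obtain ⟨r', h1, h2⟩ := h.forth hs hd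
      exact ⟨r', .inr ⟨(h.out hr x).1 he, h1⟩, h2⟩
  · rintro q r hr a q' (hd | ⟨he, hd⟩)
    · obtain ⟨r', h1, h2⟩ := h.back hr hd
      exact ⟨r', .inl h1, h2⟩
    · obtain ⟨r', h1, h2⟩ := h.back hs hd
      exact ⟨r', .inr ⟨(h.out hr x).2 he, h1⟩, h2⟩

/-- The relation between substitutions induced by relations between the constituents. -/
inductive SubstRel {C C' : FinChart A} {n : ℕ} {B B' : Fin n → FinChart A}
    (R : C.Q → C'.Q → Prop) (S : ∀ i, (B i).Q → (B' i).Q → Prop) :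
    C.Q ⊕ (Σ i, (B i).Q) → C'.Q ⊕ (Σ i, (B' i).Q) → Prop
  | inl {q q'} : R q q' → SubstRel R S (.inl q) (.inl q')
  | inr {i r r'} : S i r r' → SubstRel R S (.inr ⟨i, r⟩) (.inr ⟨i, r'⟩)

theorem Bisimilar.subst {C C' : FinChart A} {n : ℕ} (x : Fin n → ℕ) {B B' : Fin n → FinChart A}
    (h : Bisimilar C C') (hB : ∀ i, Bisimilar (B i) (B' i)) :
    Bisimilar (C.subst x B) (C'.subst x B') := by
  obtain ⟨R, h, hs⟩ := h
  choose S k ks using hB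
  refine ⟨SubstRel R S, ⟨?_, ?_, ?_⟩, .inl hs⟩
  · rintro _ _ (hr | @⟨i, _, _, hr⟩) y
    · have := fun i => (k i).out (ks i) y
      simp only [FinChart.subst, substE, h.out hr, this]
    · exact (k i).out hr y
  · rintro _ _ (hr | @⟨i, _, _, hr⟩) a (q' | ⟨j, t⟩) hd
    · obtain ⟨r', h1, h2⟩ := h.forth hr hd
      exact ⟨.inl r', h1, .inl h2⟩
    · obtain ⟨r', h1, h2⟩ := (k j).forth (ks j) hd.2
      exact ⟨.inr ⟨j, r'⟩, ⟨(h.out hr _).1 hd.1, h1⟩, .inr h2⟩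
    · exact hd.elim
    · obtain ⟨r', h0, hd⟩ := hd
      obtain ⟨t', h1, h2⟩ := (k i).forth hr hd
      rw [h0]
      exact ⟨.inr ⟨i, t'⟩, ⟨t', rfl, h1⟩, .inr h2⟩
  · rintro _ _ (hr | @⟨i, _, _, hr⟩) a (q' | ⟨j, t⟩) hd
    · obtain ⟨r', h1, h2⟩ := h.back hr hd
      exact ⟨.inl r', h1, .inl h2⟩
    · obtain ⟨r', h1, h2⟩ := (k j).back (ks j) hd.2
      exact ⟨.inr ⟨j, r'⟩, ⟨(h.out hr _).2 hd.1, h1⟩, .inr h2⟩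
    · exact hd.elim
    · obtain ⟨r', h0, hd⟩ := hd
      obtain ⟨t', h1, h2⟩ := (k i).back hr hd
      rw [h0]
      exact ⟨.inr ⟨i, t'⟩, ⟨t', rfl, h1⟩, .inr h2⟩

theorem live_var {x y : ℕ} (h : (var x : FinChart A).Live y) : y = x := by
  obtain ⟨q, -, h⟩ := h
  exact h

theorem reach_subst {C : FinChart A} {n : ℕ} {x : Fin n → ℕ} {B : Fin n → FinChart A}
    {t : (C.subst x B).Q} (h : (C.subst x B).Reach t) :
    (∃ q, t = .inl q ∧ C.Reach q) ∨ ∃ i r, t = .inr ⟨i, r⟩ ∧ (B i).Reach r := by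
  induction h with
  | start => exact .inl ⟨_, rfl, .start⟩
  | @step q a q' _ hd ih =>
    obtain ⟨q, rfl, hq⟩ | ⟨i, r, rfl, hr⟩ := ih
    · obtain q' | ⟨j, r⟩ := q'
      · exact .inl ⟨q', rfl, .step hq hd⟩
      · exact .inr ⟨j, r, rfl, .step .start hd.2⟩
    · obtain q' | ⟨j, r'⟩ := q'
      · exact hd.elim
      · obtain ⟨r'', h0, hd⟩ := hd
        exact .inr ⟨i, r'', h0, .step hr hd⟩

theorem live_subst {C : FinChart A} {n : ℕ} {x : Fin n → ℕ} {B : Fin n → FinChart A} {y : ℕ}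
    (h : (C.subst x B).Live y) : (C.Live y ∧ y ∉ Set.range x) ∨ ∃ i, (B i).Live y := by
  obtain ⟨t, ht, hy⟩ := h
  obtain ⟨q, rfl, hq⟩ | ⟨i, r, rfl, hr⟩ := reach_subst ht
  · obtain h | ⟨i, -, h⟩ := hy
    · exact .inl ⟨⟨q, hq, h.1⟩, h.2⟩
    · exact .inr ⟨i, _, .start, h⟩
  · exact .inr ⟨i, r, hr, hy⟩

theorem live_mu {C : FinChart A} {x y : ℕ} (h : (C.mu x).Live y) : C.Live y ∧ y ≠ x := by
  obtain ⟨q, hq, hy⟩ := h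
  have key : ∀ q, (C.mu x).Reach q → C.Reach q := by
    intro q hq
    induction hq with
    | start => exact .start
    | step _ hd ih =>
      obtain hd | hd := hd
      · exact .step ih hd
      · exact .step .start hd.2
  obtain ⟨h | h, hne⟩ := hy
  · exact ⟨⟨q, key q hq, h⟩, hne⟩
  · exact ⟨⟨_, .start, h.2⟩, hne⟩

theorem var_subst {n : ℕ} {x : Fin n → ℕ} (hx : Function.Injective x) (B : Fin n → FinChart A)
    (i : Fin n) : Bisimilar ((var (x i)).subst x B) (B i) := by
  refine ⟨fun t r => (t = .inl () ∧ r = (B i).start) ∨ t = .inr ⟨i, r⟩, ⟨?_, ?_, ?_⟩,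
    .inl ⟨rfl, rfl⟩⟩
  · rintro _ r (⟨rfl, rfl⟩ | rfl) y
    · constructor
      · rintro (⟨h, h'⟩ | ⟨j, h, h'⟩)
        · exact (h' ⟨i, h.symm⟩).elim
        · obtain rfl := hx h
          exact h'
      · exact fun h => .inr ⟨i, rfl, h⟩
    · rfl
  · rintro _ r (⟨rfl, rfl⟩ | rfl) a (q' | ⟨j, t⟩) hd
    · exact False.elim hd
    · obtain ⟨h, hd⟩ := hd
      obtain rfl := hx h
      exact ⟨t, hd, .inr rfl⟩
    · exact False.elim hd
    · obtain ⟨r', h0, hd⟩ := hd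
      exact ⟨r', hd, .inr h0⟩
  · rintro _ r (⟨rfl, rfl⟩ | rfl) a r' hd
    · exact ⟨.inr ⟨i, r'⟩, ⟨rfl, hd⟩, .inr rfl⟩
    · exact ⟨.inr ⟨i, r'⟩, ⟨r', rfl, hd⟩, .inr rfl⟩

theorem subst_var (C : FinChart A) {n : ℕ} (x : Fin n → ℕ) :
    Bisimilar (C.subst x fun i => var (x i)) C := by
  refine ⟨fun t q => t = .inl q, ⟨?_, ?_, ?_⟩, rfl⟩
  · rintro _ q rfl y
    constructor
    · rintro (⟨h, -⟩ | ⟨i, h, rfl⟩)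
      · exact h
      · exact h
    · intro h
      by_cases hy : y ∈ Set.range x
      · obtain ⟨i, rfl⟩ := hy
        exact .inr ⟨i, h, rfl⟩
      · exact .inl ⟨h, hy⟩
  · rintro _ q rfl a (q' | ⟨j, t⟩) hd
    · exact ⟨q', hd, rfl⟩
    · exact False.elim hd.2
  · rintro _ q rfl a q' hd
    exact ⟨.inl q', hd, rfl⟩

/-- The relation witnessing associativity of substitution. -/
inductive AssocRel {C : FinChart A} {n p : ℕ} {B : Fin n → FinChart A} {B' : Fin p → FinChart A} :
    (C.Q ⊕ (Σ i, (B i).Q)) ⊕ (Σ j, (B' j).Q) →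
      C.Q ⊕ (Σ i, (B i).Q ⊕ (Σ j, (B' j).Q)) → Prop
  | one {q} : C.Reach q → AssocRel (.inl (.inl q)) (.inl q)
  | two {i r} : AssocRel (.inl (.inr ⟨i, r⟩)) (.inr ⟨i, .inl r⟩)
  | three {i j t} : AssocRel (.inr ⟨j, t⟩) (.inr ⟨i, .inr ⟨j, t⟩⟩)

theorem subst_assoc (C : FinChart A) {n p : ℕ} (x : Fin n → ℕ) (y : Fin p → ℕ)
    (B : Fin n → FinChart A) (B' : Fin p → FinChart A) (hC : ∀ z, C.Live z → z ∈ Set.range x) :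
    Bisimilar ((C.subst x B).subst y B') (C.subst x fun i => (B i).subst y B') := by
  refine ⟨AssocRel, ⟨?_, ?_, ?_⟩, .one .start⟩
  · rintro _ _ (hq | ⟨⟩ | ⟨⟩) z
    · constructor
      · rintro (⟨⟨h, h'⟩ | ⟨i, h, h'⟩, hz⟩ | ⟨j, ⟨h, h'⟩ | ⟨i, h, h'⟩, hj⟩)
        · exact (h' (hC _ ⟨_, hq, h⟩)).elim
        · exact .inr ⟨i, h, .inl ⟨h', hz⟩⟩
        · exact (h' (hC _ ⟨_, hq, h⟩)).elim
        · exact .inr ⟨i, h, .inr ⟨j, h', hj⟩⟩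
      · rintro (⟨h, h'⟩ | ⟨i, h, ⟨h', hz⟩ | ⟨j, h', hj⟩⟩)
        · exact (h' (hC _ ⟨_, hq, h⟩)).elim
        · exact .inl ⟨.inr ⟨i, h, h'⟩, hz⟩
        · exact .inr ⟨j, .inr ⟨i, h, h'⟩, hj⟩
    · rfl
    · rfl
  · rintro _ _ (hq | @⟨i, r⟩ | @⟨i, j, t⟩) a ((q' | ⟨k, q'⟩) | ⟨k, q'⟩) hd
    · exact ⟨.inl q', hd, .one (.step hq hd)⟩
    · exact ⟨.inr ⟨k, .inl q'⟩, hd, .two⟩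
    · obtain ⟨⟨h, h'⟩ | ⟨i, h, h'⟩, hd⟩ := hd
      · exact (h' (hC _ ⟨_, hq, h⟩)).elim
      · exact ⟨.inr ⟨i, .inr ⟨k, q'⟩⟩, ⟨h, h', hd⟩, .three⟩
    · exact False.elim hd
    · obtain ⟨r', h0, hd⟩ := hd
      cases h0
      exact ⟨.inr ⟨i, .inl r'⟩, ⟨_, rfl, hd⟩, .two⟩
    · exact ⟨.inr ⟨i, .inr ⟨k, q'⟩⟩, ⟨_, rfl, hd⟩, .three⟩
    · exact False.elim hd
    · exact False.elim hd
    · obtain ⟨r', h0, hd⟩ := hd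
      cases h0
      exact ⟨.inr ⟨i, .inr ⟨j, r'⟩⟩, ⟨_, rfl, ⟨_, rfl, hd⟩⟩, .three⟩
  · rintro _ _ (hq | @⟨i, r⟩ | @⟨i, j, t⟩) a (q' | ⟨k, q' | ⟨l, q'⟩⟩) hd
    · exact ⟨.inl (.inl q'), hd, .one (.step hq hd)⟩
    · exact ⟨.inl (.inr ⟨k, q'⟩), hd, .two⟩
    · exact ⟨.inr ⟨l, q'⟩, ⟨.inr ⟨k, hd.1, hd.2.1⟩, hd.2.2⟩, .three⟩
    · exact False.elim hd
    · obtain ⟨r', h0, hd⟩ := hd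
      cases h0
      exact ⟨.inl (.inr ⟨i, q'⟩), ⟨_, rfl, hd⟩, .two⟩
    · obtain ⟨r', h0, hd⟩ := hd
      cases h0
      exact ⟨.inr ⟨l, q'⟩, hd, .three⟩
    · exact False.elim hd
    · obtain ⟨r', h0, hd⟩ := hd
      cases h0
      exact False.elim hd
    · obtain ⟨r', h0, hd⟩ := hd
      cases h0
      obtain ⟨t', h1, hd⟩ := hd
      cases h1
      exact ⟨.inr ⟨_, _⟩, ⟨_, rfl, hd⟩, .three⟩

end FinChart

/-! ## Regular behaviours -/

/-- The set `Ω` of regular behaviours: finite charts modulo bisimilarity. -/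
def RegularBehaviour (A : Type u) : Type (max 1 u) := Quotient (FinChart.setoid A)

namespace RegularBehaviour

variable {A : Type u}

/-- The class of a chart. -/
def mk (C : FinChart A) : RegularBehaviour A := Quotient.mk _ C

/-- A chart representing a regular behaviour. -/
noncomputable def rep (b : RegularBehaviour A) : FinChart A := Quotient.out b

theorem mk_rep (b : RegularBehaviour A) : mk b.rep = b := Quotient.out_eq b

theorem mk_eq_iff {C C' : FinChart A} : mk C = mk C' ↔ C.Bisimilar C' := Quotient.eq

theorem rep_mk (C : FinChart A) : (mk C).rep.Bisimilar C := mk_eq_iff.1 (mk_rep _)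

/-- Live variables of a regular behaviour. -/
def Live (b : RegularBehaviour A) (x : ℕ) : Prop :=
  Quotient.lift (fun C : FinChart A => C.Live x) (fun _ _ h => propext (FinChart.Bisimilar.live_iff h x)) b

/-- The behaviour of a variable. -/
def var (x : ℕ) : RegularBehaviour A := mk (FinChart.var x)

/-- Recursion `μ x. b`. -/
def mu (x : ℕ) (b : RegularBehaviour A) : RegularBehaviour A :=
  Quotient.map (FinChart.mu x) (fun _ _ h => FinChart.Bisimilar.mu x h) b

/-- Simultaneous substitution `b[g₁, …, gₙ / x₁, …, xₙ]`. It does not depend on the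
representatives, see `mk_subst`. -/
noncomputable def subst (b : RegularBehaviour A) {n : ℕ} (x : Fin n → ℕ)
    (g : Fin n → RegularBehaviour A) : RegularBehaviour A :=
  mk (b.rep.subst x fun i => (g i).rep)

theorem mk_subst (C : FinChart A) {n : ℕ} (x : Fin n → ℕ) (B : Fin n → FinChart A) :
    (mk C).subst x (fun i => mk (B i)) = mk (C.subst x B) :=
  mk_eq_iff.2 ((rep_mk C).subst x fun i => rep_mk (B i))

theorem exists_rep {n : ℕ} (g : Fin n → RegularBehaviour A) :
    ∃ B : Fin n → FinChart A, g = fun i => mk (B i) :=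
  ⟨fun i => (g i).rep, funext fun i => (mk_rep (g i)).symm⟩

theorem live_subst {b : RegularBehaviour A} {n : ℕ} {x : Fin n → ℕ}
    {g : Fin n → RegularBehaviour A} {y : ℕ} (h : (b.subst x g).Live y) :
    (b.Live y ∧ y ∉ Set.range x) ∨ ∃ i, (g i).Live y := by
  obtain ⟨C, rfl⟩ : ∃ C, b = mk C := ⟨_, (mk_rep b).symm⟩
  obtain ⟨B, rfl⟩ := exists_rep g
  rw [mk_subst] at h
  exact FinChart.live_subst h

theorem live_mu {b : RegularBehaviour A} {x y : ℕ} (h : (b.mu x).Live y) : b.Live y ∧ y ≠ x := by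
  obtain ⟨C, rfl⟩ : ∃ C, b = mk C := ⟨_, (mk_rep b).symm⟩
  exact FinChart.live_mu h

theorem live_var {x y : ℕ} (h : (var x : RegularBehaviour A).Live y) : y = x :=
  FinChart.live_var h

theorem var_subst {n : ℕ} {x : Fin n → ℕ} (hx : Function.Injective x)
    (g : Fin n → RegularBehaviour A) (i : Fin n) : (var (x i)).subst x g = g i := by
  obtain ⟨B, rfl⟩ := exists_rep g
  rw [var, mk_subst]
  exact mk_eq_iff.2 (FinChart.var_subst hx B i)

theorem subst_var (b : RegularBehaviour A) {n : ℕ} (x : Fin n → ℕ) :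
    b.subst x (fun i => var (x i)) = b := by
  obtain ⟨C, rfl⟩ : ∃ C, b = mk C := ⟨_, (mk_rep b).symm⟩
  unfold var
  rw [mk_subst]
  exact mk_eq_iff.2 (FinChart.subst_var C x)

theorem subst_assoc (b : RegularBehaviour A) {n p : ℕ} (x : Fin n → ℕ) (y : Fin p → ℕ)
    (g : Fin n → RegularBehaviour A) (h : Fin p → RegularBehaviour A)
    (hb : ∀ z, b.Live z → z ∈ Set.range x) :
    (b.subst x g).subst y h = b.subst x fun i => (g i).subst y h := by
  obtain ⟨C, rfl⟩ : ∃ C, b = mk C := ⟨_, (mk_rep b).symm⟩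
  obtain ⟨B, rfl⟩ := exists_rep g
  obtain ⟨B', rfl⟩ := exists_rep h
  simp only [mk_subst]
  exact mk_eq_iff.2 (FinChart.subst_assoc C x y B B' hb)

end RegularBehaviour

/-- The set `Ω(n)` of regular behaviours with live variables among `v₁, …, vₙ`. -/
abbrev Omega (A : Type u) (n : ℕ) : Type (max 1 u) :=
  {b : RegularBehaviour A // ∀ x, b.Live x → x < n}

/-! ## The category `RegBeh` -/

/-- Objects of the category of regular behaviours: natural numbers. -/
def RegBeh (_A : Type u) : Type := ℕ

namespace RegBeh

variable {A : Type u}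

/-- `RegBeh(m, n)`: the `m`-tuples of elements of `Ω(n)`. -/
abbrev Hom (A : Type u) (m n : ℕ) : Type (max 1 u) := Fin m → Omega A n

namespace Hom

/-- The tuple of variables `(v_{φ(1)}, …, v_{φ(m)})`. -/
def vars {m n : ℕ} (φ : Fin m → Fin n) : Hom A m n :=
  fun i => ⟨.var (φ i), fun _ h => (RegularBehaviour.live_var h).trans_lt (φ i).2⟩

/-- The identity `(v₁, …, vₙ)`. -/
def id (n : ℕ) : Hom A n n := vars fun i => i

/-- Sequential composition `f ; g = (f₁[g/v], …, fₘ[g/v])`. -/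
noncomputable def comp {m n p : ℕ} (f : Hom A m n) (g : Hom A n p) : Hom A m p :=
  fun i => ⟨(f i).1.subst (fun j : Fin n => (j : ℕ)) fun j => (g j).1, fun y h => by
    obtain ⟨h, hy⟩ | ⟨j, h⟩ := RegularBehaviour.live_subst h
    · exact (hy ⟨⟨y, (f i).2 y h⟩, rfl⟩).elim
    · exact (g j).2 y h⟩

/-- The unique morphism `0ₙ : 0 → n`, the empty tuple. -/
def zero (n : ℕ) : Hom A 0 n := Fin.elim0

/-- Pairing `⟨f, g⟩ = (f₁, …, fₖ, g₁, …, gₗ)`. -/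
def pair {k l m : ℕ} (f : Hom A k m) (g : Hom A l m) : Hom A (k + l) m := Fin.append f g

/-- The inclusion `(v₁, …, vₖ) : k → k + l`. -/
def inl (k l : ℕ) : Hom A k (k + l) := vars (Fin.castAdd l)

/-- The inclusion `(vₖ₊₁, …, vₖ₊ₗ) : l → k + l`. -/
def inr (k l : ℕ) : Hom A l (k + l) := vars (Fin.natAdd k)

/-- Parallel composition
`f ⊕ g = (f₁, …, fₖ, g₁[vₗ₊₁, …, vₗ₊ₙ / v₁, …, vₙ], …, gₘ[vₗ₊₁, …, vₗ₊ₙ / v₁, …, vₙ])`. -/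
noncomputable def sum {k l m n : ℕ} (f : Hom A k l) (g : Hom A m n) : Hom A (k + m) (l + n) :=
  pair (fun i => ⟨(f i).1, fun y h => ((f i).2 y h).trans_le (Nat.le_add_right l n)⟩)
    (comp g (inr l n))

/-- The codiagonal `∇ₙ = ⟨idₙ, idₙ⟩`. -/
def codiag (n : ℕ) : Hom A (n + n) n := pair (id n) (id n)

/-- The symmetry `⟨inr, inl⟩ : m + n → n + m`. -/
def swap (m n : ℕ) : Hom A (m + n) (n + m) := pair (inr n m) (inl n m)

/-- The scalar dagger `μ v_{p+1}. f` of `f : 1 → p + 1`. -/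
def mu {p : ℕ} (f : Hom A 1 (p + 1)) : Hom A 1 p :=
  fun i => ⟨(f i).1.mu p, fun y h => by
    obtain ⟨h, hy⟩ := RegularBehaviour.live_mu h
    have := (f i).2 y h
    omega⟩

/-- `id_p ⊕ σ : p + (1 + n) → p + (n + 1)`, with the domain bracketed to the left. -/
def rot (p n : ℕ) : Hom A (p + 1 + n) (p + (n + 1)) :=
  vars (Fin.append (Fin.append (Fin.castAdd (n + 1)) fun i => Fin.natAdd p (Fin.natAdd n i))
    fun i => Fin.natAdd p (Fin.castAdd 1 i))

/-- `id_p ⊕ σ : p + (n + 1) → p + (1 + n)`, with the codomain bracketed to the left. -/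
def unrot (p n : ℕ) : Hom A (p + (n + 1)) (p + 1 + n) :=
  vars (Fin.append (fun i => Fin.castAdd n (Fin.castAdd 1 i))
    (Fin.append (Fin.natAdd (p + 1)) fun i => Fin.castAdd n (Fin.natAdd p i)))

/-- The dagger of `f : n → p + n`, a solution of the system in which the `i`-th component of `f`
is fed back into the variable `v_{p+i}`. It extends `mu` by recursion on `n`: if `f = ⟨f', g⟩`
with `f'` of length `n` and `g` of length `1`, then, moving the variable of `g` in front of those
of `f'`, one has `f† = ⟨f'† ; ⟨id_p, h†⟩, h†⟩`, where `h = g ; ⟨id_{p+1}, f'†⟩ : 1 → p + 1`. -/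
noncomputable def dagger : (n p : ℕ) → Hom A n (p + n) → Hom A n p
  | 0, p, _ => zero p
  | n + 1, p, f =>
    let f' : Hom A n (p + 1 + n) := comp (fun i => f (Fin.castAdd 1 i)) (unrot p n)
    let g : Hom A 1 (p + 1 + n) := comp (fun i => f (Fin.natAdd n i)) (unrot p n)
    let k : Hom A n (p + 1) := dagger n (p + 1) f'
    let h : Hom A 1 (p + 1) := comp g (pair (id (p + 1)) k)
    pair (comp k (pair (id p) (mu h))) (mu h)

/-- The trace of `g : p + n → q + n`: take the dagger of `p + n → q + n → q + (p + n)`, where the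
second map sends `v_1, …, v_q` to themselves and the last `n` variables to the last `n`
variables, and restrict it to the first `p` components. -/
noncomputable def trace (p q n : ℕ) (g : Hom A (p + n) (q + n)) : Hom A p q :=
  comp (inl p n)
    (dagger (p + n) q (comp g (pair (inl q (p + n)) (comp (inr p n) (inr q (p + n))))))

end Hom

/-- The category of regular behaviours: objects are natural numbers, morphisms are tuples of
regular behaviours, and composition is substitution. -/
noncomputable instance category (A : Type u) : Category.{max 1 u} (RegBeh A) where
  Hom m n := Hom A m n
  id n := Hom.id n
  comp f g := Hom.comp f g
  id_comp f := funext fun i => Subtype.ext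
    (RegularBehaviour.var_subst Fin.val_injective (fun j => (f j).1) i)
  comp_id f := funext fun i => Subtype.ext (RegularBehaviour.subst_var (f i).1 _)
  assoc f _ _ := funext fun i => Subtype.ext
    (RegularBehaviour.subst_assoc (f i).1 _ _ _ _ fun z hz => ⟨⟨z, (f i).2 z hz⟩, rfl⟩)

/-- The natural number `n` as an object. -/
def of (A : Type u) (n : ℕ) : RegBeh A := n

/-- The data `(⊕, 0)` with identities as associators and unitors. -/
noncomputable instance monoidalStruct (A : Type u) : MonoidalCategoryStruct (RegBeh A) where
  tensorObj m n := of A (Nat.add m n)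
  tensorHom f g := Hom.sum f g
  whiskerLeft m _ _ f := Hom.sum (Hom.id m) f
  whiskerRight f m := Hom.sum f (Hom.id m)
  tensorUnit := of A 0
  associator k l m := eqToIso (Nat.add_assoc k l m)
  leftUnitor m := eqToIso (Nat.zero_add m)
  rightUnitor m := eqToIso (Nat.add_zero m)

/-- The axioms of a Conway theory, for a dagger operation on `RegBeh` that assigns
`f† : n → p` to each `f : n → p + n`. -/
structure IsConway (dag : ∀ n p : ℕ, Hom A n (p + n) → Hom A n p) : Prop where
  /-- `(f ; (g ⊕ id₁))† = f† ; g` -/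
  scalar_parameter : ∀ (p q : ℕ) (f : Hom A 1 (p + 1)) (g : Hom A p q),
    dag 1 q (f.comp (g.sum (Hom.id 1))) = (dag 1 p f).comp g
  /-- `(f ; ⟨id_p ⊕ 0₁, g⟩)† = f ; ⟨id_p, (g ; ⟨id_p ⊕ 0₁, f⟩)†⟩` -/
  scalar_composition : ∀ (p : ℕ) (f g : Hom A 1 (p + 1)),
    dag 1 p (f.comp (((Hom.id p).sum (Hom.zero 1)).pair g)) =
      f.comp ((Hom.id p).pair (dag 1 p (g.comp (((Hom.id p).sum (Hom.zero 1)).pair f))))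
  /-- `f†† = (f ; (id_p ⊕ ∇₁))†` -/
  scalar_double_dagger : ∀ (p : ℕ) (f : Hom A 1 (p + 2)),
    dag 1 p (dag 1 (p + 1) f) = dag 1 p (f.comp ((Hom.id p).sum (Hom.codiag 1)))
  /-- `(⟨f, g⟩ ; (id_p ⊕ σ))† = ⟨f† ; ⟨id_p, h†⟩, h†⟩` where `h = g ; ⟨id_{p+1}, f†⟩` -/
  scalar_pairing : ∀ (n p : ℕ) (f : Hom A n (p + 1 + n)) (g : Hom A 1 (p + 1 + n))
    (h : Hom A 1 (p + 1)), h = g.comp ((Hom.id (p + 1)).pair (dag n (p + 1) f)) →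
    dag (n + 1) p ((f.pair g).comp (Hom.rot p n)) =
      ((dag n (p + 1) f).comp ((Hom.id p).pair (dag 1 p h))).pair (dag 1 p h)

end RegBeh

/-! ## Strict, co-Cartesian and traced symmetric monoidal categories -/

section Monoidal

variable (C : Type u) [Category.{v} C] [S : MonoidalCategoryStruct C]

/-- The given data and `σ` form a symmetric monoidal category with braiding `σ`. -/
def IsSymmetricMonoidal (σ : ∀ X Y : C, X ⊗ Y ⟶ Y ⊗ X) : Prop :=
  ∃ (M : MonoidalCategory C) (B : SymmetricCategory C),
    M.toMonoidalCategoryStruct = S ∧ ∀ X Y : C, (B.braiding X Y).hom ≍ σ X Y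

/-- Associators and unitors are identities. -/
structure IsStrictMonoidal : Prop where
  associator : ∀ X Y Z : C, ∃ h : (X ⊗ Y) ⊗ Z = X ⊗ (Y ⊗ Z), α_ X Y Z = eqToIso h
  leftUnitor : ∀ X : C, ∃ h : 𝟙_ C ⊗ X = X, λ_ X = eqToIso h
  rightUnitor : ∀ X : C, ∃ h : X ⊗ 𝟙_ C = X, ρ_ X = eqToIso h

/-- The unit is initial and `X ⊗ Y` is a coproduct of `X` and `Y`, with the inclusions
`X ≅ X ⊗ 𝟙 ⟶ X ⊗ Y` and `Y ≅ 𝟙 ⊗ Y ⟶ X ⊗ Y`. -/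
def IsCocartesianMonoidal : Prop :=
  ∃ hI : IsInitial (𝟙_ C), ∀ X Y : C,
    Nonempty (IsColimit (BinaryCofan.mk ((ρ_ X).inv ≫ X ◁ hI.to Y) ((λ_ Y).inv ≫ hI.to X ▷ Y)))

variable {C}

/-- The axioms of a trace on a symmetric monoidal category with braiding `σ`
(Joyal, Street and Verity). -/
structure IsTrace (σ : ∀ X Y : C, X ⊗ Y ⟶ Y ⊗ X)
    (tr : ∀ X Y U : C, (X ⊗ U ⟶ Y ⊗ U) → (X ⟶ Y)) : Prop where
  naturality_left : ∀ {X X' Y U : C} (h : X' ⟶ X) (f : X ⊗ U ⟶ Y ⊗ U),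
    tr X' Y U (h ▷ U ≫ f) = h ≫ tr X Y U f
  naturality_right : ∀ {X Y Y' U : C} (f : X ⊗ U ⟶ Y ⊗ U) (k : Y ⟶ Y'),
    tr X Y' U (f ≫ k ▷ U) = tr X Y U f ≫ k
  sliding : ∀ {X Y U U' : C} (f : X ⊗ U ⟶ Y ⊗ U') (k : U' ⟶ U),
    tr X Y U (f ≫ Y ◁ k) = tr X Y U' (X ◁ k ≫ f)
  vanishing_unit : ∀ {X Y : C} (f : X ⊗ 𝟙_ C ⟶ Y ⊗ 𝟙_ C),
    tr X Y (𝟙_ C) f = (ρ_ X).inv ≫ f ≫ (ρ_ Y).hom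
  vanishing_tensor : ∀ {X Y U U' : C} (f : X ⊗ (U ⊗ U') ⟶ Y ⊗ (U ⊗ U')),
    tr X Y (U ⊗ U') f =
      tr X Y U (tr (X ⊗ U) (Y ⊗ U) U' ((α_ X U U').hom ≫ f ≫ (α_ Y U U').inv))
  superposing : ∀ {X Y Z W U : C} (g : Z ⟶ W) (f : X ⊗ U ⟶ Y ⊗ U),
    tr (Z ⊗ X) (W ⊗ Y) U ((α_ Z X U).hom ≫ (g ⊗ₘ f) ≫ (α_ W Y U).inv) = g ⊗ₘ tr X Y U f
  yanking : ∀ U : C, tr U U U (σ U U) = 𝟙 U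

end Monoidal

/-! Composition is substitution of behaviours. Its category laws were settled above on charts, and
the coproduct laws are formal consequences of `bind_vr` and componentwise pairing. The substance
lies in the dagger.

A regular behaviour is determined by its immediate observations (outputs, and transitions to further
behaviours), and coinduction makes bisimilar behaviours equal. In these terms substitution and
recursion have short descriptions: `obs_bind`, and `obs_mu`, which says that an unguarded occurrence
of the bound variable contributes nothing.

The dagger is treated as a solution of a system of equations `u = f[u]`. Such a solution is not
unique when recursion variables occur unguarded: every behaviour solves `x = x`. The predicate
`IsDag` therefore adds a leastness condition: each observation of `u i` must be reached from `f i`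
after finitely many unfoldings of unguarded recursion variables. This condition restores uniqueness
(`IsDag.unique`), because the pairs `(b[u], b[w])`, for `b` an arbitrary context, form a
bisimulation.

Scalar recursion is such a canonical solution (`isDag_mu`). Canonical solutions are stable under
successive elimination (`IsDag.bekic`), so the recursively defined dagger is canonical for tuples of
every length (`isDag_dagger`). An identity for the dagger now follows once its other side is shown
to be canonical for the same system. This yields the parameter, composition and double dagger
identities; the pairing identity unwinds the definition.

For the trace, the first `p` recursion variables never occur in the system that defines it. Hence it
equals the feedback formula `trace_eq`, which needs only the dagger of the last `n` components. The
axioms of Joyal, Street and Verity then become equational: right naturality and superposing use the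
parameter identity, sliding uses dinaturality (a case of composition), vanishing on a tensor product
uses Bekić's identity, and yanking uses the fixed point equation. -/

/-! ## Behaviours as a transition system -/

namespace FinChart

variable {A : Type u}

/-- The chart with the start node moved to `q`. -/
abbrev withStart (C : FinChart A) (q : C.Q) : FinChart A := { C with start := q }

theorem reach_of_reach_at {C : FinChart A} {q : C.Q} {r : (C.withStart q).Q}
    (hq : C.Reach q) (hr : (C.withStart q).Reach r) :
    C.Reach r := by
  refine Reach.rec (C := C.withStart q) (motive := fun r _ => C.Reach r) hq ?_ hr
  exact fun _ hd ih => .step ih hd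

/-- The start node of `C` enters a substitution only as its start node, so this is an equality of
charts and not merely a bisimilarity. -/
theorem subst_at_inl (C : FinChart A) {n : ℕ} (x : Fin n → ℕ) (B : Fin n → FinChart A) (q : C.Q) :
    (C.subst x B).withStart (.inl q) = (C.withStart q).subst x B := by
  unfold withStart subst
  congr 1
  · funext t a t'
    rcases t with t | t <;> rcases t' with t' | t' <;> rfl
  · funext t y
    rcases t with t | t <;> rfl

/-- No transition leaves the component of `B i`, so the graph of its inclusion is a bisimulation. -/
theorem subst_at_inr (C : FinChart A) {n : ℕ} (x : Fin n → ℕ) (B : Fin n → FinChart A)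
    (i : Fin n) (r : (B i).Q) :
    Bisimilar ((C.subst x B).withStart (.inr ⟨i, r⟩)) ((B i).withStart r) := by
  refine ⟨fun t q => t = .inr ⟨i, q⟩, ⟨?_, ?_, ?_⟩, rfl⟩
  · rintro _ q rfl y
    exact Iff.rfl
  · rintro _ q rfl a t hd
    obtain ⟨r', rfl, hd'⟩ : ∃ r', t = .inr ⟨i, r'⟩ ∧ (B i).D q a r' := by
      rcases t with t | t
      · exact False.elim hd
      · exact hd
    exact ⟨r', hd', rfl⟩
  · rintro _ q rfl a r' hd
    exact ⟨.inr ⟨i, r'⟩, ⟨r', rfl, hd⟩, rfl⟩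

/-- A run of the recursion stays in the left copy until it first uses a transition borrowed from the
start node; from then on it lives in the right copy, which is the recursion itself. Both copies of a
state are therefore related to that state. -/
theorem mu_at (C : FinChart A) (x : ℕ) (q : C.Q) :
    Bisimilar ((C.mu x).withStart q)
      ((C.withStart q).subst (fun _ : Fin 1 => x) fun _ => C.mu x) := by
  refine ⟨fun r t => t = .inl r ∨ t = .inr ⟨0, r⟩, ⟨?_, ?_, ?_⟩, .inl rfl⟩
  · rintro r _ (rfl | rfl) y
    · constructor
      · rintro ⟨h | ⟨h, h'⟩, hy⟩
        · exact .inl ⟨h, fun ⟨_, e⟩ => hy e.symm⟩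
        · exact .inr ⟨0, h, .inl h', hy⟩
      · rintro (⟨h, hy⟩ | ⟨i, h, h' | ⟨_, h'⟩, hy⟩)
        · exact ⟨.inl h, fun e => hy ⟨0, e.symm⟩⟩
        · exact ⟨.inr ⟨h, h'⟩, hy⟩
        · exact ⟨.inr ⟨h, h'⟩, hy⟩
    · exact Iff.rfl
  · rintro r _ (rfl | rfl) a q' hd
    · rcases hd with hd | ⟨h, hd⟩
      · exact ⟨.inl q', hd, .inl rfl⟩
      · exact ⟨.inr ⟨0, q'⟩, ⟨h, .inl hd⟩, .inr rfl⟩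
    · exact ⟨.inr ⟨0, q'⟩, ⟨q', rfl, hd⟩, .inr rfl⟩
  · rintro r _ (rfl | rfl) a t hd
    · rcases t with q' | ⟨i, q'⟩
      · exact ⟨q', .inl hd, .inl rfl⟩
      · obtain rfl := Subsingleton.elim i 0
        obtain ⟨h, hd | ⟨-, hd⟩⟩ := hd
        · exact ⟨q', .inr ⟨h, hd⟩, .inr rfl⟩
        · exact ⟨q', .inr ⟨h, hd⟩, .inr rfl⟩
    · rcases t with q' | t
      · exact False.elim hd
      · obtain ⟨r', h0, hd⟩ := hd
        exact ⟨r', hd, .inr h0⟩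

end FinChart

namespace RegularBehaviour

variable {A : Type u}

/-- The behaviour `b` outputs the variable `x` immediately. -/
def Out (b : RegularBehaviour A) (x : ℕ) : Prop := ∃ C, b = mk C ∧ C.E C.start x

/-- Transitions between behaviours. -/
def Tr (b : RegularBehaviour A) (a : A) (b' : RegularBehaviour A) : Prop :=
  ∃ C q, b = mk C ∧ C.D C.start a q ∧ b' = mk (C.withStart q)

theorem out_mk {C : FinChart A} {x : ℕ} : (mk C).Out x ↔ C.E C.start x := by
  refine ⟨?_, fun h => ⟨C, rfl, h⟩⟩
  rintro ⟨B, h, hx⟩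
  obtain ⟨R, h, hs⟩ := mk_eq_iff.1 h
  exact (h.out hs x).2 hx

/-- Transitions can be computed in any representative: a bisimulation between two charts also
relates the charts restarted at related states. -/
theorem tr_mk {C : FinChart A} {a : A} {b : RegularBehaviour A} :
    (mk C).Tr a b ↔ ∃ q, C.D C.start a q ∧ b = mk (C.withStart q) := by
  refine ⟨?_, fun ⟨q, h, hb⟩ => ⟨C, q, rfl, h, hb⟩⟩
  rintro ⟨B, q, h, hd, rfl⟩
  obtain ⟨R, h, hs⟩ := mk_eq_iff.1 h
  obtain ⟨r, hr, hR⟩ := h.back hs hd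
  exact ⟨r, hr, (mk_eq_iff (C := C.withStart r) (C' := B.withStart q)).2 ⟨R, ⟨h.out, h.forth, h.back⟩, hR⟩ |>.symm⟩

theorem exists_mk (b : RegularBehaviour A) : ∃ C, b = mk C := ⟨_, (mk_rep b).symm⟩

/-- Coinduction: bisimilar behaviours are equal. -/
theorem eq_of_bisim (R : RegularBehaviour A → RegularBehaviour A → Prop)
    (out : ∀ {b c}, R b c → ∀ x, b.Out x ↔ c.Out x)
    (forth : ∀ {b c}, R b c → ∀ {a b'}, b.Tr a b' → ∃ c', c.Tr a c' ∧ R b' c')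
    (back : ∀ {b c}, R b c → ∀ {a c'}, c.Tr a c' → ∃ b', b.Tr a b' ∧ R b' c')
    {b c : RegularBehaviour A} (h : R b c) : b = c := by
  obtain ⟨B, rfl⟩ := exists_mk b
  obtain ⟨C, rfl⟩ := exists_mk c
  -- Pull `R` back to states, each state standing for the behaviour that starts there.
  refine mk_eq_iff.2 ⟨fun q r => R (mk (B.withStart q)) (mk (C.withStart r)), ⟨?_, ?_, ?_⟩, h⟩
  · intro q r hR x
    exact out_mk.symm.trans ((out hR x).trans out_mk)
  · intro q r hR a q' hd
    obtain ⟨c', hc, hR'⟩ := forth hR (tr_mk.2 ⟨q', hd, rfl⟩)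
    obtain ⟨r', hd', rfl⟩ := tr_mk.1 hc
    exact ⟨r', hd', hR'⟩
  · intro q r hR a r' hd
    obtain ⟨c', hc, hR'⟩ := back hR (tr_mk.2 ⟨r', hd, rfl⟩)
    obtain ⟨q', hd', rfl⟩ := tr_mk.1 hc
    exact ⟨q', hd', hR'⟩

theorem Out.live {b : RegularBehaviour A} {x : ℕ} (h : b.Out x) : b.Live x := by
  obtain ⟨C, rfl, h⟩ := h
  exact ⟨_, .start, h⟩

theorem Tr.live {b b' : RegularBehaviour A} {a : A} {x : ℕ} (h : b.Tr a b') (hx : b'.Live x) :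
    b.Live x := by
  obtain ⟨C, q, rfl, h, rfl⟩ := h
  obtain ⟨r, hr, hx⟩ := hx
  exact ⟨r, FinChart.reach_of_reach_at (.step .start h) hr, hx⟩

/-! ### Observations of variables, substitutions and recursions -/

theorem out_var {x y : ℕ} : (var x : RegularBehaviour A).Out y ↔ y = x := out_mk

theorem not_tr_var {x : ℕ} {a : A} {b : RegularBehaviour A} : ¬ (var x).Tr a b := by
  intro h
  obtain ⟨_, h, _⟩ := tr_mk.1 h
  exact h

theorem out_subst {b : RegularBehaviour A} {n : ℕ} {x : Fin n → ℕ}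
    {g : Fin n → RegularBehaviour A} {y : ℕ} :
    (b.subst x g).Out y ↔ (b.Out y ∧ y ∉ Set.range x) ∨ ∃ i, b.Out (x i) ∧ (g i).Out y := by
  obtain ⟨C, rfl⟩ := exists_mk b
  obtain ⟨B, rfl⟩ := exists_rep g
  simp only [mk_subst, out_mk]
  exact Iff.rfl

theorem tr_subst {b : RegularBehaviour A} {n : ℕ} {x : Fin n → ℕ}
    {g : Fin n → RegularBehaviour A} {a : A} {c : RegularBehaviour A} :
    (b.subst x g).Tr a c ↔
      (∃ b', b.Tr a b' ∧ c = b'.subst x g) ∨ ∃ i, b.Out (x i) ∧ (g i).Tr a c := by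
  obtain ⟨C, rfl⟩ := exists_mk b
  obtain ⟨B, rfl⟩ := exists_rep g
  simp only [mk_subst, out_mk, tr_mk]
  constructor
  · rintro ⟨q | ⟨i, r⟩, hd, rfl⟩
    · exact .inl ⟨_, ⟨q, hd, rfl⟩, (congrArg mk (FinChart.subst_at_inl C x B q)).trans
        (mk_subst (C.withStart q) x B).symm⟩
    · exact .inr ⟨i, hd.1, r, hd.2, mk_eq_iff.2 (FinChart.subst_at_inr _ _ _ _ _)⟩
  · rintro (⟨_, ⟨q, hd, rfl⟩, rfl⟩ | ⟨i, h, r, hd, rfl⟩)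
    · exact ⟨.inl q, hd, (mk_subst (C.withStart q) x B).trans
        (congrArg mk (FinChart.subst_at_inl C x B q)).symm⟩
    · exact ⟨.inr ⟨i, r⟩, ⟨h, hd⟩, (mk_eq_iff.2 (FinChart.subst_at_inr _ _ _ _ _)).symm⟩

/-- At the start node, what an output `x` would add are the start node's own outputs, so nothing new
appears. -/
theorem out_mu {b : RegularBehaviour A} {x y : ℕ} : (b.mu x).Out y ↔ b.Out y ∧ y ≠ x := by
  obtain ⟨C, rfl⟩ := exists_mk b
  change (mk (C.mu x)).Out y ↔ _
  simp only [out_mk, FinChart.mu, FinChart.muE]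
  tauto

/-- The start node gains no new transitions; the targets are unfolded by `FinChart.mu_at`. -/
theorem tr_mu {b : RegularBehaviour A} {x : ℕ} {a : A} {c : RegularBehaviour A} :
    (b.mu x).Tr a c ↔ ∃ b', b.Tr a b' ∧ c = b'.subst (fun _ : Fin 1 => x) fun _ => b.mu x := by
  obtain ⟨C, rfl⟩ := exists_mk b
  have key (q : C.Q) : mk ((C.mu x).withStart q) =
      (mk (C.withStart q)).subst (fun _ : Fin 1 => x) fun _ => (mk C).mu x :=
    (mk_eq_iff.2 (FinChart.mu_at C x q)).trans (mk_subst _ _ _).symm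
  change (mk (C.mu x)).Tr a c ↔ _
  simp only [tr_mk]
  constructor
  · rintro ⟨q, hd | ⟨-, hd⟩, rfl⟩
    · exact ⟨_, ⟨q, hd, rfl⟩, key q⟩
    · exact ⟨_, ⟨q, hd, rfl⟩, key q⟩
  · rintro ⟨_, ⟨q, hd, rfl⟩, rfl⟩
    exact ⟨q, .inl hd, (key q).symm⟩

/-- Only the values of a substitution at live variables matter. -/
theorem subst_congr {m n : ℕ} {x : Fin m → ℕ} {y : Fin n → ℕ} {g : Fin m → RegularBehaviour A}
    {h : Fin n → RegularBehaviour A} {S : Set ℕ} (h₁ : ∀ i, x i ∈ S → (∃ j, y j = x i ∧ h j = g i) ∨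
      (x i ∉ Set.range y ∧ g i = var (x i)))
    (h₂ : ∀ j, y j ∈ S → (∃ i, x i = y j ∧ g i = h j) ∨ (y j ∉ Set.range x ∧ h j = var (y j)))
    {b : RegularBehaviour A} (hb : ∀ z, b.Live z → z ∈ S) : b.subst x g = b.subst y h := by
  -- The hypotheses are symmetric in `(x, g)` and `(y, h)`, so one inclusion is proved with
  -- everything generalized and then used in both directions.
  have aux : ∀ {m n : ℕ} {x : Fin m → ℕ} {y : Fin n → ℕ} {g : Fin m → RegularBehaviour A}
    {h : Fin n → RegularBehaviour A} (_ : ∀ i, x i ∈ S → (∃ j, y j = x i ∧ h j = g i) ∨ (x i ∉ Set.range y ∧ g i = var (x i)))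
    (_ : ∀ j, y j ∈ S → (∃ i, x i = y j ∧ g i = h j) ∨ (y j ∉ Set.range x ∧ h j = var (y j)))
    {b : RegularBehaviour A} (_ : ∀ z, b.Live z → z ∈ S),
      (∀ z, (b.subst x g).Out z → (b.subst y h).Out z) ∧
      (∀ a c, (b.subst x g).Tr a c → (b.subst y h).Tr a c ∨
        ∃ b' : RegularBehaviour A, (∀ z, b'.Live z → z ∈ S) ∧ c = b'.subst x g ∧ (b.subst y h).Tr a (b'.subst y h)) := by
    intro m n x y g h h₁ h₂ b hb
    constructor
    · intro z hz
      rw [out_subst] at hz ⊢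
      rcases hz with ⟨hz, hn⟩ | ⟨i, hi, hz⟩
      · by_cases hr : z ∈ Set.range y
        · obtain ⟨j, rfl⟩ := hr
          refine .inr ⟨j, hz, ?_⟩
          rcases h₂ j (hb _ hz.live) with ⟨i, e, -⟩ | ⟨-, e⟩
          · exact (hn ⟨i, e⟩).elim
          · rw [e, out_var]
        · exact .inl ⟨hz, hr⟩
      · rcases h₁ i (hb _ hi.live) with ⟨j, e, e'⟩ | ⟨hn, e⟩
        · exact .inr ⟨j, e ▸ hi, e' ▸ hz⟩
        · rw [e, out_var] at hz
          subst hz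
          exact .inl ⟨hi, hn⟩
    · intro a c hc
      rw [tr_subst] at hc
      rcases hc with ⟨b', hb', rfl⟩ | ⟨i, hi, hc⟩
      · exact .inr ⟨b', fun z hz => hb z (hb'.live hz), rfl, tr_subst.2 (.inl ⟨b', hb', rfl⟩)⟩
      · rcases h₁ i (hb _ hi.live) with ⟨j, e, e'⟩ | ⟨hn, e⟩
        · exact .inl (tr_subst.2 (.inr ⟨j, e ▸ hi, e' ▸ hc⟩))
        · rw [e] at hc
          exact (not_tr_var hc).elim
  -- Equality is included because a transition made by a substituted behaviour has the same target
  -- on both sides.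
  refine eq_of_bisim (fun c d => c = d ∨
    ∃ b, (∀ z, b.Live z → z ∈ S) ∧ c = b.subst x g ∧ d = b.subst y h) ?_ ?_ ?_ (.inr ⟨b, hb, rfl, rfl⟩)
  · rintro _ _ (rfl | ⟨b, hb, rfl, rfl⟩) z
    · rfl
    · exact ⟨(aux h₁ h₂ hb).1 z, (aux h₂ h₁ hb).1 z⟩
  · rintro _ _ (rfl | ⟨b, hb, rfl, rfl⟩) a c hc
    · exact ⟨c, hc, .inl rfl⟩
    · rcases (aux h₁ h₂ hb).2 a c hc with h | ⟨b', hb', rfl, h⟩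
      · exact ⟨c, h, .inl rfl⟩
      · exact ⟨_, h, .inr ⟨b', hb', rfl, rfl⟩⟩
  · rintro _ _ (rfl | ⟨b, hb, rfl, rfl⟩) a c hc
    · exact ⟨c, hc, .inl rfl⟩
    · rcases (aux h₂ h₁ hb).2 a c hc with h | ⟨b', hb', rfl, h⟩
      · exact ⟨c, h, .inl rfl⟩
      · exact ⟨_, h, .inr ⟨b', hb', rfl, rfl⟩⟩

end RegularBehaviour

/-! ## Substitution and observations on the sets `Ω(n)` -/

namespace RegBeh

variable {A : Type u}

/-- The variable `vᵢ` as an element of `Ω(n)`. -/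
def vr {n : ℕ} (i : Fin n) : Omega A n :=
  ⟨.var i, fun _ h => (RegularBehaviour.live_var h).trans_lt i.2⟩

/-- Substitution `b[g₁, …, gₘ / v₁, …, vₘ]`. -/
noncomputable def bind {m n : ℕ} (b : Omega A m) (g : Hom A m n) : Omega A n :=
  Hom.comp (fun _ : Fin 1 => b) g 0

theorem comp_apply {m n p : ℕ} (f : Hom A m n) (g : Hom A n p) (i : Fin m) :
    f.comp g i = bind (f i) g := rfl

theorem vars_apply {m n : ℕ} (φ : Fin m → Fin n) (i : Fin m) :
    (Hom.vars φ : Hom A m n) i = vr (φ i) := rfl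

theorem id_apply {n : ℕ} (i : Fin n) : (Hom.id n : Hom A n n) i = vr i := rfl

theorem inl_apply {k l : ℕ} (i : Fin k) : (Hom.inl k l : Hom A k (k + l)) i = vr (i.castAdd l) := rfl

theorem inr_apply {k l : ℕ} (i : Fin l) : (Hom.inr k l : Hom A l (k + l)) i = vr (i.natAdd k) := rfl

@[simp] theorem bind_vr {m n : ℕ} (i : Fin m) (g : Hom A m n) : bind (vr i) g = g i :=
  congrFun (Category.id_comp (X := of A m) (Y := of A n) g) i

@[simp] theorem bind_id {m : ℕ} (b : Omega A m) : bind b (Hom.id m) = b :=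
  congrFun (Category.comp_id (X := of A 1) (Y := of A m) fun _ => b) (0 : Fin 1)

theorem bind_bind {m n p : ℕ} (b : Omega A m) (g : Hom A m n) (h : Hom A n p) :
    bind (bind b g) h = bind b (g.comp h) :=
  congrFun (Category.assoc (W := of A 1) (X := of A m) (Y := of A n) (Z := of A p)
    (fun _ => b) g h) (0 : Fin 1)

theorem comp_assoc {m n p q : ℕ} (f : Hom A m n) (g : Hom A n p) (h : Hom A p q) :
    (f.comp g).comp h = f.comp (g.comp h) :=
  funext fun _ => bind_bind _ _ _

@[simp] theorem id_comp {m n : ℕ} (f : Hom A m n) : (Hom.id m).comp f = f :=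
  funext fun _ => bind_vr _ _

@[simp] theorem comp_id {m n : ℕ} (f : Hom A m n) : f.comp (Hom.id n) = f :=
  funext fun _ => bind_id _

@[simp] theorem pair_castAdd {k l m : ℕ} (f : Hom A k m) (g : Hom A l m) (i : Fin k) :
    f.pair g (i.castAdd l) = f i := Fin.append_left _ _ _

@[simp] theorem pair_natAdd {k l m : ℕ} (f : Hom A k m) (g : Hom A l m) (i : Fin l) :
    f.pair g (i.natAdd k) = g i := Fin.append_right _ _ _

theorem hom_ext_pair {k l m : ℕ} {f g : Hom A (k + l) m}
    (h₁ : ∀ i : Fin k, f (i.castAdd l) = g (i.castAdd l))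
    (h₂ : ∀ i : Fin l, f (i.natAdd k) = g (i.natAdd k)) : f = g :=
  funext fun i => Fin.addCases h₁ h₂ i

theorem pair_comp {k l m n : ℕ} (f : Hom A k m) (g : Hom A l m) (h : Hom A m n) :
    (f.pair g).comp h = (f.comp h).pair (g.comp h) :=
  hom_ext_pair (fun i => by simp [comp_apply]) (fun i => by simp [comp_apply])

@[simp] theorem inl_comp_pair {k l m : ℕ} (f : Hom A k m) (g : Hom A l m) :
    (Hom.inl k l).comp (f.pair g) = f :=
  funext fun i => by rw [comp_apply, inl_apply, bind_vr, pair_castAdd]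

@[simp] theorem inr_comp_pair {k l m : ℕ} (f : Hom A k m) (g : Hom A l m) :
    (Hom.inr k l).comp (f.pair g) = g :=
  funext fun i => by rw [comp_apply, inr_apply, bind_vr, pair_natAdd]

theorem pair_inl_inr_comp {k l m : ℕ} (f : Hom A (k + l) m) :
    ((Hom.inl k l).comp f).pair ((Hom.inr k l).comp f) = f :=
  hom_ext_pair (fun i => by simp [comp_apply, inl_apply]) (fun i => by simp [comp_apply, inr_apply])

/-- `f ⊕ g = ⟨f ; inl, g ; inr⟩`. -/
theorem sum_eq {k l m n : ℕ} (f : Hom A k l) (g : Hom A m n) :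
    f.sum g = (f.comp (Hom.inl l n)).pair (g.comp (Hom.inr l n)) := by
  refine congrArg (fun h => Hom.pair h _) (funext fun i => Subtype.ext ?_)
  exact (RegularBehaviour.subst_var (f i).1 _).symm

/-! ### Observations -/

/-- Immediate observations of `b`: outputs of a variable, and transitions to a behaviour. -/
def Obs {n : ℕ} (b : Omega A n) : Fin n ⊕ A × Omega A n → Prop
  | .inl k => b.1.Out k
  | .inr (a, c) => b.1.Tr a c.1

@[simp] theorem obs_vr {n : ℕ} {i : Fin n} {o : Fin n ⊕ A × Omega A n} :
    Obs (vr i) o ↔ o = .inl i := by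
  rcases o with k | ⟨a, c⟩
  · exact RegularBehaviour.out_var.trans (by simp [Fin.ext_iff])
  · exact ⟨fun h => (RegularBehaviour.not_tr_var h).elim, by simp⟩

/-- All live variables of `b` are substituted, so no output of `b` survives as such. -/
theorem obs_bind {m n : ℕ} {b : Omega A m} {g : Hom A m n} {o : Fin n ⊕ A × Omega A n} :
    Obs (bind b g) o ↔ (∃ a b', Obs b (.inr (a, b')) ∧ o = .inr (a, bind b' g)) ∨
      ∃ i, Obs b (.inl i) ∧ Obs (g i) o := by
  rcases o with k | ⟨a, c⟩
  · refine RegularBehaviour.out_subst.trans ⟨?_, ?_⟩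
    · rintro (⟨h, h'⟩ | h)
      · exact (h' ⟨⟨_, b.2 _ h.live⟩, rfl⟩).elim
      · exact .inr h
    · rintro (⟨_, _, _, ⟨⟩⟩ | h)
      exact .inr h
  · refine RegularBehaviour.tr_subst.trans ⟨?_, ?_⟩
    · rintro (⟨b', h, e⟩ | h)
      · exact .inl ⟨a, ⟨b', fun x hx => b.2 x (h.live hx)⟩, h, congrArg (fun c => Sum.inr (a, c)) (Subtype.ext e)⟩
      · exact .inr h
    · rintro (⟨_, b', h, ⟨⟩⟩ | h)
      · exact .inl ⟨b'.1, h, rfl⟩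
      · exact .inr h

/-- Observations of the same kind with related targets. -/
inductive ObsRel {n : ℕ} (R : Omega A n → Omega A n → Prop) :
    Fin n ⊕ A × Omega A n → Fin n ⊕ A × Omega A n → Prop
  | out (k : Fin n) : ObsRel R (.inl k) (.inl k)
  | tr {a : A} {c c' : Omega A n} : R c c' → ObsRel R (.inr (a, c)) (.inr (a, c'))

/-- Liveness is inherited backwards along transitions, so targets stay in `Ω(n)` and coinduction can
be carried out inside it. -/
theorem eq_of_bisim {n : ℕ} (R : Omega A n → Omega A n → Prop)
    (forth : ∀ {b c}, R b c → ∀ o, Obs b o → ∃ o', Obs c o' ∧ ObsRel R o o')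
    (back : ∀ {b c}, R b c → ∀ o', Obs c o' → ∃ o, Obs b o ∧ ObsRel R o o')
    {b c : Omega A n} (h : R b c) : b = c := by
  refine Subtype.ext (RegularBehaviour.eq_of_bisim
    (fun b c => ∃ b' c' : Omega A n, R b' c' ∧ b = b'.1 ∧ c = c'.1) ?_ ?_ ?_ ⟨b, c, h, rfl, rfl⟩)
  · rintro _ _ ⟨b, c, h, rfl, rfl⟩ x
    constructor
    · intro hx
      obtain ⟨_, ho, ⟨⟩⟩ := forth h (.inl ⟨x, b.2 x hx.live⟩) hx
      exact ho
    · intro hx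
      obtain ⟨_, ho, ⟨⟩⟩ := back h (.inl ⟨x, c.2 x hx.live⟩) hx
      exact ho
  · rintro _ _ ⟨b, c, h, rfl, rfl⟩ a b' hb
    obtain ⟨_, ho, h'⟩ := forth h (.inr (a, ⟨b', fun x hx => b.2 x (hb.live hx)⟩)) hb
    cases h' with
    | tr hR => exact ⟨_, ho, _, _, hR, rfl, rfl⟩
  · rintro _ _ ⟨b, c, h, rfl, rfl⟩ a b' hb
    obtain ⟨_, ho, h'⟩ := back h (.inr (a, ⟨b', fun x hx => c.2 x (hb.live hx)⟩)) hb
    cases h' with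
    | tr hR => exact ⟨_, ho, _, _, hR, rfl, rfl⟩

/-! ### Systems of recursive definitions

The variables of a system `f : ι → Ω(N)` are divided by `d : Fin N → Fin p ⊕ ι` into parameters
and recursion variables. -/

section System

variable {N p : ℕ} {ι : Type} (d : Fin N → Fin p ⊕ ι)

/-- The substitution that keeps the parameters and replaces recursion variables by `u`. -/
def close (u : ι → Omega A p) : Hom A N p := fun j => Sum.elim vr u (d j)

/-- Observations of `b[u]` that do not come from an output of a recursion variable. -/
def Dir (u : ι → Omega A p) (b : Omega A N) (o : Fin p ⊕ A × Omega A p) : Prop :=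
  (∃ a b', Obs b (.inr (a, b')) ∧ o = .inr (a, bind b' (close d u))) ∨
    ∃ j k, Obs b (.inl j) ∧ d j = .inl k ∧ o = .inl k

variable {d}

theorem obs_bind_close {u : ι → Omega A p} {b : Omega A N} {o : Fin p ⊕ A × Omega A p} :
    Obs (bind b (close d u)) o ↔
      Dir d u b o ∨ ∃ j i, Obs b (.inl j) ∧ d j = .inr i ∧ Obs (u i) o := by
  rw [obs_bind]
  constructor
  · rintro (h | ⟨j, hj, h⟩)
    · exact .inl (.inl h)
    · simp only [close] at h
      rcases hd : d j with k | i <;> rw [hd] at h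
      · exact .inl (.inr ⟨j, k, hj, hd, obs_vr.1 h⟩)
      · exact .inr ⟨j, i, hj, hd, h⟩
  · rintro ((h | ⟨j, k, hj, hd, rfl⟩) | ⟨j, i, hj, hd, h⟩)
    · exact .inl h
    · exact .inr ⟨j, hj, by simp [close, hd]⟩
    · exact .inr ⟨j, hj, by simpa [close, hd] using h⟩

variable (d)

/-- Observations of the `i`-th component of the system `f` that are reached after finitely many
unfoldings of recursion variables; recursion variables in targets are replaced by `u`. -/
inductive Unf (f : ι → Omega A N) (u : ι → Omega A p) : ι → Fin p ⊕ A × Omega A p → Prop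
  | base {i o} : Dir d u (f i) o → Unf f u i o
  | step {i j i' o} : Obs (f i) (.inl j) → d j = .inr i' → Unf f u i' o → Unf f u i o

/-- `u` is the canonical solution of the system `f`. -/
structure IsDag (f : ι → Omega A N) (u : ι → Omega A p) : Prop where
  fixed : ∀ i, u i = bind (f i) (close d u)
  least : ∀ {i o}, Obs (u i) o → Unf d f u i o

variable {d}

/-- Converse of `IsDag.least`, valid for every solution of the equations. -/
theorem Unf.obs {f : ι → Omega A N} {u : ι → Omega A p} (hu : ∀ i, u i = bind (f i) (close d u))
    {i : ι} {o : Fin p ⊕ A × Omega A p} (h : Unf d f u i o) : Obs (u i) o := by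
  induction h with
  | base h => rw [hu]; exact obs_bind_close.2 (.inl h)
  | step h hd _ ih => rw [hu]; exact obs_bind_close.2 (.inr ⟨_, _, h, hd, ih⟩)

/-- An observation of `b[u]` is either direct in `b` or, by leastness of `u`, a finite unfolding in
`f`. Both forms mention `u` only in the targets, so they can be replayed with `w`, where the fixed
point equation turns them back into observations. -/
theorem IsDag.unique {f : ι → Omega A N} {u w : ι → Omega A p} (hu : IsDag d f u)
    (hw : IsDag d f w) : u = w := by
  -- The contexts `b` are arbitrary: the targets of transitions again have the form `b'[u]` and
  -- `b'[w]`.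
  let R : Omega A p → Omega A p → Prop :=
    fun x y => ∃ b : Omega A N, x = bind b (close d u) ∧ y = bind b (close d w)
  have dir {u w : ι → Omega A p} {b : Omega A N} {o : Fin p ⊕ A × Omega A p} (h : Dir d u b o) :
      ∃ o', Dir d w b o' ∧
        ObsRel (fun x y => ∃ b : Omega A N, x = bind b (close d u) ∧ y = bind b (close d w)) o o' := by
    rcases h with ⟨a, b', hb, rfl⟩ | ⟨j, k, hj, hd, rfl⟩
    · exact ⟨_, .inl ⟨a, b', hb, rfl⟩, .tr ⟨b', rfl, rfl⟩⟩
    · exact ⟨_, .inr ⟨j, k, hj, hd, rfl⟩, .out k⟩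
  have unf {u w : ι → Omega A p} {i : ι} {o : Fin p ⊕ A × Omega A p} (h : Unf d f u i o) :
      ∃ o', Unf d f w i o' ∧
        ObsRel (fun x y => ∃ b : Omega A N, x = bind b (close d u) ∧ y = bind b (close d w)) o o' := by
    induction h with
    | base h =>
      obtain ⟨o', h, h'⟩ := dir h
      exact ⟨o', .base h, h'⟩
    | step h hd _ ih =>
      obtain ⟨o', h1, h2⟩ := ih
      exact ⟨o', .step h hd h1, h2⟩
  have key {u w : ι → Omega A p} (hu : IsDag d f u) (hw : IsDag d f w) (b : Omega A N)
      (o : Fin p ⊕ A × Omega A p) (h : Obs (bind b (close d u)) o) :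
      ∃ o', Obs (bind b (close d w)) o' ∧
        ObsRel (fun x y => ∃ b : Omega A N, x = bind b (close d u) ∧ y = bind b (close d w)) o o' := by
    rcases obs_bind_close.1 h with h | ⟨j, i, hj, hd, h⟩
    · obtain ⟨o', h1, h2⟩ := dir (w := w) h
      exact ⟨o', obs_bind_close.2 (.inl h1), h2⟩
    · obtain ⟨o', h1, h2⟩ := unf (w := w) (hu.least h)
      exact ⟨o', obs_bind_close.2 (.inr ⟨j, i, hj, hd, h1.obs hw.fixed⟩), h2⟩
  funext i
  refine eq_of_bisim R ?_ ?_ ⟨f i, hu.fixed i, hw.fixed i⟩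
  · rintro _ _ ⟨b, rfl, rfl⟩ o h
    exact key hu hw b o h
  · rintro _ _ ⟨b, rfl, rfl⟩ o h
    obtain ⟨o', h1, h2⟩ := key hw hu b o h
    refine ⟨o', h1, ?_⟩
    cases h2 with
    | out k => exact .out k
    | tr hR =>
      obtain ⟨b, e, e'⟩ := hR
      exact .tr ⟨b, e', e⟩

/-- When the only unguarded recursion is of a component to itself, unfolding it repeats the same
direct observations. Those already make up all observations of `u i`, so a single `Unf.base`
suffices. -/
theorem IsDag.of_obs {f : ι → Omega A N} {u : ι → Omega A p} (hi : ∀ i j, d j = .inr i →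
    ∀ i', Obs (f i') (.inl j) → i = i') (h : ∀ i o, Obs (u i) o ↔ Dir d u (f i) o) :
    IsDag d f u := by
  refine ⟨fun i => eq_of_bisim (fun b c => b = c ∨ b = u i ∧ c = bind (f i) (close d u)) ?_ ?_
    (.inr ⟨rfl, rfl⟩), fun ho => .base ((h _ _).1 ho)⟩
  all_goals
    have obs (o : Fin p ⊕ A × Omega A p) : Obs (bind (f i) (close d u)) o ↔ Obs (u i) o := by
      rw [obs_bind_close, h]
      refine ⟨?_, .inl⟩
      rintro (h' | ⟨j, i', hj, hd, h'⟩)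
      · exact h'
      · obtain rfl := hi i' j hd i hj
        exact (h _ _).1 h'
    have refl (o : Fin p ⊕ A × Omega A p) :
        ObsRel (fun b c => b = c ∨ b = u i ∧ c = bind (f i) (close d u)) o o := by
      rcases o with k | ⟨a, c⟩
      · exact .out k
      · exact .tr (.inl rfl)
  · rintro b c (rfl | ⟨rfl, rfl⟩) o ho
    · exact ⟨o, ho, refl o⟩
    · exact ⟨o, (obs o).2 ho, refl o⟩
  · rintro b c (rfl | ⟨rfl, rfl⟩) o ho
    · exact ⟨o, ho, refl o⟩
    · exact ⟨o, (obs o).1 ho, refl o⟩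

/-! ### Renaming the variables and reindexing the equations of a system -/

theorem close_comp_vars {M : ℕ} (φ : Fin M → Fin N) (u : ι → Omega A p) :
    (Hom.vars φ).comp (close d u) = close (d ∘ φ) u :=
  funext fun i => by simp [comp_apply, vars_apply, close]

theorem dir_bind_vars {M : ℕ} {φ : Fin M → Fin N} {u : ι → Omega A p} {b : Omega A M}
    {o : Fin p ⊕ A × Omega A p} : Dir d u (bind b (Hom.vars φ)) o ↔ Dir (d ∘ φ) u b o := by
  constructor
  · rintro (⟨a, b', h, rfl⟩ | ⟨j, k, h, hd, rfl⟩)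
    · rcases obs_bind.1 h with ⟨a, b', hb, ⟨⟩⟩ | ⟨i, h, h'⟩
      · exact .inl ⟨_, b', hb, by rw [bind_bind, close_comp_vars]⟩
      · simp [vars_apply] at h'
    · rcases obs_bind.1 h with ⟨a, b', h, ⟨⟩⟩ | ⟨i, hb, h'⟩
      simp only [vars_apply, obs_vr, Sum.inl.injEq] at h'
      subst h'
      exact .inr ⟨i, k, hb, hd, rfl⟩
  · rintro (⟨a, b', h, rfl⟩ | ⟨j, k, h, hd, rfl⟩)
    · exact .inl ⟨a, _, obs_bind.2 (.inl ⟨a, b', h, rfl⟩), by rw [bind_bind, close_comp_vars]⟩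
    · exact .inr ⟨φ j, k, obs_bind.2 (.inr ⟨j, h, by simp [vars_apply]⟩), hd, rfl⟩

theorem unf_bind_vars {M : ℕ} {φ : Fin M → Fin N} {u : ι → Omega A p} {f : ι → Omega A M} {i : ι}
    {o : Fin p ⊕ A × Omega A p} :
    Unf d (fun i => bind (f i) (Hom.vars φ)) u i o ↔ Unf (d ∘ φ) f u i o := by
  constructor
  · intro h
    induction h with
    | base h => exact .base (dir_bind_vars.1 h)
    | step h hd _ ih =>
      rcases obs_bind.1 h with ⟨a, b', h, ⟨⟩⟩ | ⟨i, hb, h'⟩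
      simp only [vars_apply, obs_vr, Sum.inl.injEq] at h'
      subst h'
      exact .step hb hd ih
  · intro h
    induction h with
    | base h => exact .base (dir_bind_vars.2 h)
    | @step i j _ _ h hd _ ih =>
      exact .step (j := φ j) (obs_bind.2 (.inr ⟨j, h, by simp [vars_apply]⟩)) hd ih

/-- A renaming of variables can be absorbed into the division `d`. This is why `d` is an arbitrary
map and not just the standard splitting of `p + n`. -/
theorem isDag_bind_vars {M : ℕ} {φ : Fin M → Fin N} {u : ι → Omega A p} {f : ι → Omega A M} :
    IsDag d (fun i => bind (f i) (Hom.vars φ)) u ↔ IsDag (d ∘ φ) f u := by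
  constructor
  · exact fun h => ⟨fun i => by rw [h.fixed i, bind_bind, close_comp_vars],
      fun ho => unf_bind_vars.1 (h.least ho)⟩
  · exact fun h => ⟨fun i => by rw [h.fixed i, bind_bind, close_comp_vars],
      fun ho => unf_bind_vars.2 (h.least ho)⟩

theorem close_reindex {κ : Type} (e : ι ≃ κ) (u : ι → Omega A p) :
    close (Sum.map id e ∘ d) (u ∘ e.symm) = close d u :=
  funext fun j => by rcases h : d j <;> simp [close, h]

theorem dir_reindex {κ : Type} (e : ι ≃ κ) {u : ι → Omega A p} {b : Omega A N}
    {o : Fin p ⊕ A × Omega A p} : Dir (Sum.map id e ∘ d) (u ∘ e.symm) b o ↔ Dir d u b o := by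
  refine or_congr (by rw [close_reindex]) (exists₂_congr fun j k => ?_)
  rcases h : d j <;> simp [h]

theorem IsDag.reindex {κ : Type} (e : ι ≃ κ) {f : ι → Omega A N} {u : ι → Omega A p}
    (h : IsDag d f u) : IsDag (Sum.map id e ∘ d) (f ∘ e.symm) (u ∘ e.symm) := by
  refine ⟨fun k => by rw [close_reindex]; exact h.fixed _, fun {k o} ho => ?_⟩
  have key {i : ι} (h : Unf d f u i o) :
      Unf (Sum.map id e ∘ d) (f ∘ e.symm) (u ∘ e.symm) (e i) o := by
    clear ho
    induction h with
    | base h => exact .base ((dir_reindex e).2 (by simpa using h))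
    | @step i j i' _ h hd _ ih => exact .step (j := j) (i' := e i') (by simpa using h) (by simp [hd]) ih
  simpa using key (h.least ho)

/-- Bekić's identity: systems can be solved by successive elimination. -/
theorem IsDag.bekic {M : ℕ} {κ : Type} {d₁ : Fin N → Fin M ⊕ ι} {d₂ : Fin M → Fin p ⊕ κ}
    {f : ι → Omega A N} {g : κ → Omega A N} {k : ι → Omega A M} {w : κ → Omega A p}
    (hk : IsDag d₁ f k) (hw : IsDag d₂ (fun c => bind (g c) (close d₁ k)) w) :
    IsDag (fun j => Sum.elim (Sum.map id Sum.inr ∘ d₂) (Sum.inr ∘ Sum.inl) (d₁ j))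
      (Sum.elim f g) (Sum.elim (fun i => bind (k i) (close d₂ w)) w) := by
  set d : Fin N → Fin p ⊕ (ι ⊕ κ) :=
    fun j => Sum.elim (Sum.map id Sum.inr ∘ d₂) (Sum.inr ∘ Sum.inl) (d₁ j) with hd
  set F := Sum.elim f g
  set U : ι ⊕ κ → Omega A p := Sum.elim (fun i => bind (k i) (close d₂ w)) w
  have hclose : (close d₁ k).comp (close d₂ w) = close d U := by
    funext j
    rcases h : d₁ j with m | i
    · rcases h' : d₂ m <;> simp [comp_apply, close, h, hd, h', U]
    · simp [comp_apply, close, h, hd, U]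
  -- `P o₁ o`: an observation `o₁` over the intermediate variables gives rise to `o` in the combined
  -- system. Either `o₁` is a transition whose target gets closed, or a genuine parameter, or a
  -- variable of the second block that unfolds to `o`.
  let P (o₁ : Fin M ⊕ A × Omega A M) (o : Fin p ⊕ A × Omega A p) : Prop :=
    (∃ a c, o₁ = .inr (a, c) ∧ o = .inr (a, bind c (close d₂ w))) ∨
    (∃ m l, o₁ = .inl m ∧ d₂ m = .inl l ∧ o = .inl l) ∨
    ∃ m c, o₁ = .inl m ∧ d₂ m = .inr c ∧ Unf d F U (.inr c) o
  have dir {x : ι ⊕ κ} {o₁ o} (h : Dir d₁ k (F x) o₁) (hP : P o₁ o) : Unf d F U x o := by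
    rcases h with ⟨a, b', hb, rfl⟩ | ⟨j, m, hj, hdj, rfl⟩
    · rcases hP with ⟨a, c, ⟨⟩, rfl⟩ | ⟨m, l, ⟨⟩, _⟩ | ⟨m, c, ⟨⟩, _⟩
      exact .base (.inl ⟨_, b', hb, by rw [bind_bind, hclose]⟩)
    · rcases hP with ⟨a, c, ⟨⟩, _⟩ | ⟨m, l, ⟨⟩, h, rfl⟩ | ⟨m, c, ⟨⟩, h, hU⟩
      · exact .base (.inr ⟨j, l, hj, by simp [hd, hdj, h], rfl⟩)
      · exact .step hj (by simp [hd, hdj, h]) hU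
  have unf₁ {i o₁ o} (h : Unf d₁ f k i o₁) (hP : P o₁ o) : Unf d F U (.inl i) o := by
    induction h with
    | base h => exact dir h hP
    | @step i j _ _ hj hdj _ ih => exact .step (j := j) hj (by simp [hd, hdj]) (ih hP)
  have obs₂ {c o₁ o} (h : Obs (bind (g c) (close d₁ k)) o₁) (hP : P o₁ o) :
      Unf d F U (.inr c) o := by
    rcases obs_bind_close.1 h with h | ⟨j, i, hj, hdj, h⟩
    · exact dir h hP
    · exact .step (j := j) hj (by simp [hd, hdj]) (unf₁ (hk.least h) hP)
  have hP {b : Omega A M} {o} (h : Dir d₂ w b o) : ∃ o₁, Obs b o₁ ∧ P o₁ o := by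
    rcases h with ⟨a, b', hb, rfl⟩ | ⟨j, l, hj, hdj, rfl⟩
    · exact ⟨_, hb, .inl ⟨a, b', rfl, rfl⟩⟩
    · exact ⟨_, hj, .inr (.inl ⟨j, l, rfl, hdj, rfl⟩)⟩
  -- One unfolding in the reduced system for `g` may hide finitely many unfoldings of `f`; `obs₂`
  -- inserts them.
  have unf₂ {c o} (h : Unf d₂ (fun c => bind (g c) (close d₁ k)) w c o) :
      Unf d F U (.inr c) o := by
    induction h with
    | base h =>
      obtain ⟨o₁, h, h'⟩ := hP h
      exact obs₂ h h'
    | @step i j i' o h hdj _ ih => exact obs₂ h (.inr (.inr ⟨j, i', rfl, hdj, ih⟩))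
  refine ⟨?_, ?_⟩
  · rintro (i | c)
    · rw [← hclose, ← bind_bind]
      exact congrArg (fun b => bind b (close d₂ w)) (hk.fixed i)
    · rw [← hclose, ← bind_bind]
      exact hw.fixed c
  · rintro (i | c) o ho
    · rcases obs_bind_close.1 (show Obs (bind (k i) (close d₂ w)) o from ho) with h | ⟨j, c, hj, hdj, h⟩
      · obtain ⟨o₁, h, h'⟩ := hP h
        exact unf₁ (hk.least h) h'
      · exact unf₁ (hk.least hj) (.inr (.inr ⟨j, c, rfl, hdj, unf₂ (hw.least h)⟩))
    · exact unf₂ (hw.least ho)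

end System

end RegBeh

/-! ### The dagger as canonical solution -/

namespace RegBeh

variable {A : Type u}

/-- The division of `p + n` variables into `p` parameters and `n` recursion variables. -/
def split (p n : ℕ) : Fin (p + n) → Fin p ⊕ Fin n := finSumFinEquiv.symm

@[simp] theorem split_castAdd {p n : ℕ} (i : Fin p) : split p n (i.castAdd n) = .inl i :=
  finSumFinEquiv_symm_apply_castAdd i

@[simp] theorem split_natAdd {p n : ℕ} (i : Fin n) : split p n (i.natAdd p) = .inr i :=
  finSumFinEquiv_symm_apply_natAdd i

theorem split_eq_inl {p n : ℕ} {j : Fin (p + n)} {i : Fin p} :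
    split p n j = .inl i ↔ j = i.castAdd n := by
  rw [split, Equiv.symm_apply_eq, finSumFinEquiv_apply_left]

theorem split_eq_inr {p n : ℕ} {j : Fin (p + n)} {i : Fin n} :
    split p n j = .inr i ↔ j = i.natAdd p := by
  rw [split, Equiv.symm_apply_eq, finSumFinEquiv_apply_right]

theorem close_split {p n : ℕ} (u : Hom A n p) : close (split p n) u = (Hom.id p).pair u :=
  hom_ext_pair (fun i => by simp [close, id_apply]) (fun i => by simp [close])

/-- Chart recursion substitutes for the single variable with index `p`, whereas `bind` substitutes
for all of them. The two agree because the parameters are replaced by themselves. -/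
theorem subst_mu {p : ℕ} (b : Omega A (p + 1)) (f : Hom A 1 (p + 1)) (i : Fin 1) :
    b.1.subst (fun _ : Fin 1 => p) (fun _ => (f.mu i).1) =
      (bind b ((Hom.id p).pair f.mu)).1 := by
  refine RegularBehaviour.subst_congr (S := {z | z < p + 1}) ?_ ?_ b.2
  · refine fun i' _ => .inl ⟨Fin.natAdd p i', by simp, ?_⟩
    rw [pair_natAdd, Subsingleton.elim i i']
  · intro j _
    induction j using Fin.addCases with
    | left j =>
      refine .inr ⟨?_, ?_⟩
      · rintro ⟨_, h⟩
        exact j.2.ne' h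
      · rw [pair_castAdd]
        rfl
    | right j =>
      refine .inl ⟨j, by simp, ?_⟩
      rw [pair_natAdd, Subsingleton.elim i j]

theorem obs_mu {p : ℕ} (f : Hom A 1 (p + 1)) (i : Fin 1) (o : Fin p ⊕ A × Omega A p) :
    Obs (f.mu i) o ↔ Dir (split p 1) f.mu (f i) o := by
  rw [Dir, close_split]
  rcases o with k | ⟨a, c⟩
  · refine RegularBehaviour.out_mu.trans ⟨fun h => .inr ⟨k.castAdd 1, k, h.1, by simp, rfl⟩, ?_⟩
    rintro (⟨_, _, _, ⟨⟩⟩ | ⟨j, k', h, hd, ⟨⟩⟩)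
    rw [split_eq_inl] at hd
    subst hd
    exact ⟨h, k.2.ne⟩
  · refine RegularBehaviour.tr_mu.trans ⟨?_, ?_⟩
    · rintro ⟨b', h, e⟩
      exact .inl ⟨a, ⟨b', fun x hx => (f i).2 x (h.live hx)⟩, h,
        congrArg (fun c => Sum.inr (a, c)) (Subtype.ext (e.trans (subst_mu ⟨b', _⟩ f i)))⟩
    · rintro (⟨_, b', h, ⟨⟩⟩ | ⟨_, _, _, _, ⟨⟩⟩)
      exact ⟨b'.1, h, (subst_mu _ f i).symm⟩

theorem isDag_mu {p : ℕ} (f : Hom A 1 (p + 1)) : IsDag (split p 1) f f.mu :=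
  .of_obs (fun _ _ _ _ _ => Subsingleton.elim _ _) (obs_mu f)

/-- Each step of the recursion defining the dagger is one elimination in the sense of `IsDag.bekic`,
with the last equation as second block. -/
theorem isDag_dagger : ∀ (n p : ℕ) (f : Hom A n (p + n)), IsDag (split p n) f (Hom.dagger n p f)
  | 0, p, f => ⟨fun i => i.elim0, fun {i} => i.elim0⟩
  | n + 1, p, f => by
    -- The index map behind `Hom.unrot`: the variable of the last equation becomes a parameter,
    -- placed before those of the first `n`.
    let φ : Fin (p + (n + 1)) → Fin (p + 1 + n) :=
      Fin.append (fun i => Fin.castAdd n (Fin.castAdd 1 i))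
        (Fin.append (Fin.natAdd (p + 1)) fun i => Fin.castAdd n (Fin.natAdd p i))
    let f₁ : Hom A n (p + (n + 1)) := fun i => f (Fin.castAdd 1 i)
    let f₂ : Hom A 1 (p + (n + 1)) := fun i => f (Fin.natAdd n i)
    let k : Hom A n (p + 1) := Hom.dagger n (p + 1) (f₁.comp (Hom.vars φ))
    let h : Hom A 1 (p + 1) := (f₂.comp (Hom.vars φ)).comp ((Hom.id (p + 1)).pair k)
    have hdag : Hom.dagger (n + 1) p f = (k.comp ((Hom.id p).pair h.mu)).pair h.mu := rfl
    have hk : IsDag (split (p + 1) n ∘ φ) f₁ k := isDag_bind_vars.1 (isDag_dagger n (p + 1) _)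
    have hh : h = fun c => bind (f₂ c) (close (split (p + 1) n ∘ φ) k) := by
      rw [← close_comp_vars, close_split]
      exact comp_assoc _ _ _
    have hw : IsDag (split p 1) (fun c => bind (f₂ c) (close (split (p + 1) n ∘ φ) k)) h.mu := by
      rw [← hh]
      exact isDag_mu h
    have := (hk.bekic hw).reindex finSumFinEquiv
    rw [hdag]
    convert this using 1
    · funext j
      induction j using Fin.addCases with
      | left j => simp [φ]
      | right j =>
        induction j using Fin.addCases with
        | left j => simp [φ]
        | right j => simp [φ]
    · exact hom_ext_pair (fun i => by simp [f₁]) (fun i => by simp [f₂])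
    · exact hom_ext_pair (fun i => by simp [comp_apply, close_split]) (fun i => by simp)

/-- The working principle for all later dagger identities: it suffices to exhibit a canonical
solution. -/
theorem dagger_eq {n p : ℕ} {f : Hom A n (p + n)} {u : Hom A n p} (h : IsDag (split p n) f u) :
    Hom.dagger n p f = u := (isDag_dagger n p f).unique h

theorem dagger_one {p : ℕ} (f : Hom A 1 (p + 1)) : Hom.dagger 1 p f = f.mu :=
  dagger_eq (isDag_mu f)

/-! ### Identities for the dagger, from uniqueness of canonical solutions -/

/-- The fixed point identity. -/
theorem dagger_fixed {n p : ℕ} (f : Hom A n (p + n)) :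
    Hom.dagger n p f = f.comp ((Hom.id p).pair (Hom.dagger n p f)) := by
  rw [← close_split]
  exact funext (isDag_dagger n p f).fixed

theorem zero_eq {n : ℕ} (f : Hom A 0 n) : f = Hom.zero n := funext fun i => i.elim0

theorem sum_id_comp_pair {p q n m : ℕ} (g : Hom A p q) (h : Hom A n m) (r : Hom A q m) :
    (g.sum (Hom.id n)).comp (r.pair h) = (g.comp r).pair h := by
  rw [sum_eq, pair_comp, comp_assoc, comp_assoc, inl_comp_pair, inr_comp_pair, id_comp]

/-- The parameter identity. -/
theorem dagger_parameter {n p q : ℕ} (f : Hom A n (p + n)) (g : Hom A p q) :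
    Hom.dagger n q (f.comp (g.sum (Hom.id n))) = (Hom.dagger n p f).comp g := by
  set u := Hom.dagger n p f with hu
  have hf := isDag_dagger n p f
  rw [← hu] at hf
  have hclose : (g.sum (Hom.id n)).comp (close (split q n) (u.comp g)) =
      (close (split p n) u).comp g := by
    rw [close_split, close_split, sum_id_comp_pair, comp_id, pair_comp, id_comp]
  have hl (k : Fin p) : g.sum (Hom.id n) (k.castAdd n) = bind (g k) (Hom.inl q n) := by
    rw [sum_eq, pair_castAdd, comp_apply]
  have hr (k : Fin n) : g.sum (Hom.id n) (k.natAdd p) = vr (k.natAdd q) := by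
    rw [sum_eq, pair_natAdd, id_comp, inr_apply]
  refine dagger_eq ⟨fun i => ?_, fun {i o} ho => ?_⟩
  · rw [comp_apply, comp_apply, bind_bind, hclose, ← bind_bind, ← hf.fixed]
  -- Replay an unfolding of `f` in the substituted system. Where it ends in a parameter `k`, it
  -- continues with an observation of `g k`.
  · have key {i o₁} (h : Unf (split p n) f u i o₁) :
        ((∃ a c, o₁ = .inr (a, c) ∧ o = .inr (a, bind c g)) ∨
          ∃ k, o₁ = .inl k ∧ Obs (g k) o) →
        Unf (split q n) (f.comp (g.sum (Hom.id n))) (u.comp g) i o := by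
      clear ho
      induction h with
      | base h =>
        intro hP
        rcases h with ⟨a, b', hb, rfl⟩ | ⟨j, k, hj, hd, rfl⟩
        · obtain ⟨a, c, ⟨⟩, rfl⟩ | ⟨k, ⟨⟩, _⟩ := hP
          exact .base (.inl ⟨_, _, obs_bind.2 (.inl ⟨_, b', hb, rfl⟩),
            by rw [bind_bind, bind_bind, hclose]⟩)
        · obtain ⟨a, c, ⟨⟩, _⟩ | ⟨k, ⟨⟩, hk⟩ := hP
          rw [split_eq_inl] at hd
          subst hd
          rcases o with l | ⟨a, c⟩
          · refine .base (.inr ⟨l.castAdd n, l, obs_bind.2 (.inr ⟨_, hj, ?_⟩), by simp, rfl⟩)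
            rw [hl]
            exact obs_bind.2 (.inr ⟨l, hk, by simp [inl_apply]⟩)
          -- The target `c` is weakened to `q + n` variables; closing the system then gives `c`
          -- back.
          · refine .base (.inl ⟨a, bind c (Hom.inl q n), obs_bind.2 (.inr ⟨_, hj, ?_⟩), ?_⟩)
            · rw [hl]
              exact obs_bind.2 (.inl ⟨a, c, hk, rfl⟩)
            · rw [close_split, bind_bind, inl_comp_pair, bind_id]
      | @step i j i' _ hj hd _ ih =>
        intro hP
        rw [split_eq_inr] at hd
        subst hd
        refine .step (j := i'.natAdd q) (obs_bind.2 (.inr ⟨_, hj, ?_⟩)) (by simp) (ih hP)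
        rw [hr, obs_vr]
    rcases obs_bind.1 ho with ⟨a, c, h, rfl⟩ | ⟨k, h, h'⟩
    · exact key (hf.least h) (.inl ⟨a, c, rfl, rfl⟩)
    · exact key (hf.least h) (.inr ⟨k, rfl, h'⟩)

/-- The composition identity. -/
theorem dagger_composition {m n p : ℕ} (f : Hom A n (p + m)) (g : Hom A m (p + n)) :
    Hom.dagger n p (f.comp ((Hom.inl p n).pair g)) =
      f.comp ((Hom.id p).pair (Hom.dagger m p (g.comp ((Hom.inl p m).pair f)))) := by
  set u := Hom.dagger m p (g.comp ((Hom.inl p m).pair f)) with hu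
  have hg := isDag_dagger m p (g.comp ((Hom.inl p m).pair f))
  rw [← hu] at hg
  set w := f.comp ((Hom.id p).pair u) with hw
  set F := f.comp ((Hom.inl p n).pair g) with hF
  have hcf : ((Hom.inl p m).pair f).comp (close (split p m) u) = close (split p n) w := by
    rw [close_split, close_split, pair_comp, inl_comp_pair]
  have hcg : ((Hom.inl p n).pair g).comp (close (split p n) w) = close (split p m) u := by
    have h : g.comp (close (split p n) w) = u := by
      rw [← hcf, ← comp_assoc]
      exact (funext hg.fixed).symm
    rw [pair_comp, h, close_split, close_split, inl_comp_pair]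
  have dir {i o} (h : Dir (split p m) u (f i) o) : Unf (split p n) F w i o := by
    rcases h with ⟨a, b', hb, rfl⟩ | ⟨j, k, hj, hd, rfl⟩
    · exact .base (.inl ⟨a, _, obs_bind.2 (.inl ⟨a, b', hb, rfl⟩), by rw [bind_bind, hcg]⟩)
    · rw [split_eq_inl] at hd
      subst hd
      exact .base (.inr ⟨k.castAdd n, k, obs_bind.2 (.inr ⟨_, hj, by simp [inl_apply]⟩),
        by simp, rfl⟩)
  have link {i : Fin n} {j : Fin m} {o} (hi : Obs (f i) (.inl (j.natAdd p))) (ho : Obs (g j) o) :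
      Obs (F i) o := obs_bind.2 (.inr ⟨_, hi, by simpa using ho⟩)
  -- Regrouping of alternating unfoldings: a step of `f` followed by rounds "`g`, then `f`" is a
  -- sequence of rounds "`f`, then `g`" followed by a step of `f`.
  have unf {j o} (h : Unf (split p m) (g.comp ((Hom.inl p m).pair f)) u j o) :
      ∀ i, Obs (f i) (.inl (j.natAdd p)) → Unf (split p n) F w i o := by
    induction h with
    | base h =>
      intro i hi
      rcases h with ⟨a, b', hb, rfl⟩ | ⟨j, k, hj, hd, rfl⟩
      · rcases obs_bind.1 hb with ⟨a, b', hb', ⟨⟩⟩ | ⟨x, hx, hb⟩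
        · exact .base (.inl ⟨_, b', link hi hb', by rw [bind_bind, hcf]⟩)
        · induction x using Fin.addCases with
          | left x => simp [inl_apply] at hb
          | right x =>
            rw [pair_natAdd] at hb
            exact .step (link hi hx) (by simp) (dir (.inl ⟨a, b', hb, rfl⟩))
      · rcases obs_bind.1 hj with ⟨a, b', hb, ⟨⟩⟩ | ⟨x, hx, hb⟩
        induction x using Fin.addCases with
        | left x =>
          simp only [pair_castAdd, inl_apply, obs_vr, Sum.inl.injEq] at hb
          subst hb
          rw [split_castAdd, Sum.inl.injEq] at hd
          subst hd
          exact .base (.inr ⟨_, x, link hi hx, by simp, rfl⟩)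
        | right x =>
          rw [pair_natAdd] at hb
          exact .step (link hi hx) (by simp) (dir (.inr ⟨j, k, hb, hd, rfl⟩))
    | @step _ j j' _ hj hd _ ih =>
      intro i hi
      rcases obs_bind.1 hj with ⟨a, b', hb, ⟨⟩⟩ | ⟨x, hx, hb⟩
      rw [split_eq_inr] at hd
      subst hd
      induction x using Fin.addCases with
      | left x =>
        simp only [pair_castAdd, inl_apply, obs_vr, Sum.inl.injEq] at hb
        have := congrArg (split p m) hb
        simp at this
      | right x =>
        rw [pair_natAdd] at hb
        exact .step (link hi hx) (by simp) (ih x hb)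
  refine dagger_eq ⟨fun i => ?_, fun {i o} ho => ?_⟩
  · rw [hw, hF, comp_apply, comp_apply, bind_bind, ← hw, hcg, close_split]
  · rw [hw, comp_apply, ← close_split] at ho
    rcases obs_bind_close.1 ho with h | ⟨j, k, hj, hd, h⟩
    · exact dir h
    · rw [split_eq_inr] at hd
      subst hd
      exact unf (hg.least h) i hj

/-- The double dagger identity for scalar morphisms. -/
theorem mu_mu {p : ℕ} (f : Hom A 1 (p + 2)) :
    Hom.mu (p := p) (Hom.mu (p := p + 1) f) = (f.comp ((Hom.id p).sum (Hom.codiag 1))).mu := by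
  rw [← dagger_one (f.comp _)]
  set k : Hom A 1 (p + 1) := Hom.mu (p := p + 1) f with hk
  set w := k.mu with hw
  -- `φ` identifies the last two variables. After this merging both sides have the same direct
  -- observations, namely those of `f` with both recursion variables discarded.
  let φ : Fin (p + 1 + 1) → Fin (p + 1) := Fin.append (fun i => i) (Fin.natAdd p)
  have hφ : (Hom.id p).sum (Hom.codiag 1) = (Hom.vars φ : Hom A (p + 1 + 1) (p + 1)) := by
    rw [sum_eq]
    refine @hom_ext_pair _ p 2 _ _ _ (fun i => ?_) fun i => ?_
    · rw [pair_castAdd, id_comp, inl_apply, vars_apply]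
      change _ = vr (φ (Fin.castAdd 1 (Fin.castAdd 1 i)))
      simp only [φ, Fin.append_left]
    · rw [pair_natAdd, vars_apply]
      refine Fin.addCases (m := 1) (n := 1) (fun j => ?_) (fun j => ?_) i
      · rw [comp_apply, Hom.codiag, pair_castAdd, id_apply, bind_vr, inr_apply]
        change _ = vr (φ (Fin.castAdd 1 (Fin.natAdd p j)))
        simp only [φ, Fin.append_left]
      · rw [comp_apply, Hom.codiag, pair_natAdd, id_apply, bind_vr, inr_apply]
        obtain rfl := Subsingleton.elim j 0
        change _ = vr (φ (Fin.natAdd (p + 1) 0))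
        simp only [φ, Fin.append_right]
  have hclose : (close (split (p + 1) 1) k).comp (close (split p 1) w) =
      close (split p 1 ∘ φ) w := by
    refine hom_ext_pair (fun i => ?_) fun i => ?_
    · simp [comp_apply, close, φ]
    · simp only [comp_apply, close, split_natAdd, Sum.elim_inr, Function.comp_apply, φ,
        Fin.append_right]
      exact ((isDag_mu k).fixed i).symm
  refine (dagger_eq ?_).symm
  rw [hφ]
  refine isDag_bind_vars.2 (.of_obs (fun _ _ _ _ _ => Subsingleton.elim _ _) fun i o => ?_)
  rw [hw, obs_mu]
  constructor
  · rintro (⟨a, b', h, rfl⟩ | ⟨j, l, h, hd, rfl⟩)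
    · rcases (obs_mu f _ _).1 h with ⟨a, b', h', ⟨⟩⟩ | ⟨_, _, _, _, ⟨⟩⟩
      exact .inl ⟨_, b', h', by rw [bind_bind, hclose]⟩
    · rcases (obs_mu f _ _).1 h with ⟨a, b', h', ⟨⟩⟩ | ⟨j', _, h', hd', ⟨⟩⟩
      rw [split_eq_inl] at hd'
      subst hd'
      exact .inr ⟨_, l, h', by simpa [φ] using hd, rfl⟩
  · rintro (⟨a, b', h, rfl⟩ | ⟨j, l, h, hd, rfl⟩)
    · exact .inl ⟨a, _, (obs_mu f _ _).2 (.inl ⟨a, b', h, rfl⟩), by rw [bind_bind, hclose]⟩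
    · induction j using Fin.addCases (m := p + 1) (n := 1) with
      | left j =>
        simp only [Function.comp_apply, φ, Fin.append_left] at hd
        exact .inr ⟨j, l, (obs_mu f _ _).2 (.inr ⟨_, j, h, by simp, rfl⟩), hd, rfl⟩
      | right j => simp [φ] at hd

end RegBeh

/-! ### The axioms of a Conway theory -/

namespace RegBeh

variable {A : Type u}

theorem id_sum_zero (p n : ℕ) : (Hom.id p).sum (Hom.zero n) = (Hom.inl p n : Hom A p (p + n)) := by
  rw [sum_eq, id_comp]
  exact funext fun i => pair_castAdd _ _ i

theorem rot_comp_unrot (p n : ℕ) : (Hom.rot p n).comp (Hom.unrot p n) =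
    (Hom.id (p + 1 + n) : Hom A _ _) := by
  refine hom_ext_pair (Fin.addCases (fun i => ?_) fun i => ?_) fun i => ?_ <;>
    simp [Hom.rot, Hom.unrot, comp_apply, vars_apply, id_apply]

theorem isConway_dagger : IsConway (A := A) Hom.dagger where
  scalar_parameter _ _ f g := dagger_parameter f g
  scalar_composition p f g := by
    rw [id_sum_zero]
    exact dagger_composition f g
  scalar_double_dagger p f := by
    rw [dagger_one, dagger_one, dagger_one]
    exact mu_mu f
  scalar_pairing n p f g h hh := by
    have hf : Hom.comp (fun i => (f.pair g).comp (Hom.rot p n) (Fin.castAdd 1 i))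
        (Hom.unrot p n) = f := by
      funext i
      rw [comp_apply, comp_apply, bind_bind, rot_comp_unrot, bind_id, pair_castAdd]
    have hg : Hom.comp (fun i => (f.pair g).comp (Hom.rot p n) (Fin.natAdd n i))
        (Hom.unrot p n) = g := by
      funext i
      rw [comp_apply, comp_apply, bind_bind, rot_comp_unrot, bind_id, pair_natAdd]
    rw [dagger_one, Hom.dagger]
    simp only [hf, hg, ← hh]

/-! ### The trace -/

/-- The system defining the trace uses only the last `n` of its `p + n` recursion variables, since
the renaming `φ` misses the first `p`. Its solution is thus fixed by the last `n` equations, and the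
first `p` components are plain substitution instances. -/
theorem trace_eq {p q n : ℕ} (g : Hom A (p + n) (q + n)) :
    Hom.trace p q n g = ((Hom.inl p n).comp g).comp
      ((Hom.id q).pair (Hom.dagger n q ((Hom.inr p n).comp g))) := by
  set w := Hom.dagger n q ((Hom.inr p n).comp g) with hw
  have hw' := isDag_dagger n q ((Hom.inr p n).comp g)
  rw [← hw] at hw'
  let φ : Fin (q + n) → Fin (q + (p + n)) :=
    Fin.append (Fin.castAdd (p + n)) fun i => Fin.natAdd q (Fin.natAdd p i)
  have hφ : (Hom.inl q (p + n)).pair ((Hom.inr p n).comp (Hom.inr q (p + n))) =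
      (Hom.vars φ : Hom A (q + n) (q + (p + n))) :=
    hom_ext_pair (fun i => by simp [inl_apply, vars_apply, φ])
      fun i => by simp [inr_apply, vars_apply, φ, comp_apply]
  have hl (i : Fin q) : (split q (p + n) ∘ φ) (i.castAdd n) = .inl i := by simp [φ]
  have hr (i : Fin n) : (split q (p + n) ∘ φ) (i.natAdd q) = .inr (i.natAdd p) := by simp [φ]
  set u : Hom A (p + n) q := g.comp ((Hom.id q).pair w) with hu
  have hgi (i : Fin n) : (Hom.inr p n).comp g i = g (i.natAdd p) := bind_vr _ _
  have hui (i : Fin n) : u (i.natAdd p) = w i := by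
    rw [hw'.fixed, hgi, hu, comp_apply, close_split]
  have hclose : close (split q (p + n) ∘ φ) u = close (split q n) w :=
    hom_ext_pair (fun i => by simp only [close, hl, split_castAdd, Sum.elim_inl])
      fun i => by simp only [close, hr, split_natAdd, Sum.elim_inr, hui]
  have dir {b : Omega A (q + n)} {o} (h : Dir (split q n) w b o) :
      Dir (split q (p + n) ∘ φ) u b o := by
    refine h.imp (by rw [hclose]; exact _root_.id) ?_
    rintro ⟨j, k, h, hd, rfl⟩
    rw [split_eq_inl] at hd
    subst hd
    exact ⟨_, k, h, hl k, rfl⟩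
  have unf {i o} (h : Unf (split q n) ((Hom.inr p n).comp g) w i o) :
      Unf (split q (p + n) ∘ φ) g u (i.natAdd p) o := by
    induction h with
    | base h => exact .base (dir (by rwa [← hgi]))
    | @step i j i' _ h hd _ ih =>
      rw [split_eq_inr] at hd
      subst hd
      exact .step (by rwa [← hgi]) (hr _) ih
  have main : Hom.dagger (p + n) q (g.comp (Hom.vars φ)) = u := by
    refine dagger_eq (isDag_bind_vars.2 ⟨fun i => ?_, fun {i o} ho => ?_⟩)
    · rw [hclose, close_split, hu, comp_apply]
    · rw [hu, comp_apply, ← close_split] at ho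
      rcases obs_bind_close.1 ho with h | ⟨j, k, hj, hd, h⟩
      · exact .base (dir h)
      · rw [split_eq_inr] at hd
        subst hd
        exact .step hj (hr _) (unf (hw'.least h))
  rw [Hom.trace, hφ, main, comp_assoc]

/-- Bekić's identity for a system of two blocks, the second of which is solved first. -/
theorem dagger_pair {m n p : ℕ} (f : Hom A m (p + (m + n))) (g : Hom A n (p + (m + n)))
    {φ : Fin (p + (m + n)) → Fin (p + m + n)} (hφ : φ = Fin.cast (Nat.add_assoc p m n).symm)
    {k : Hom A n (p + m)} (hk : k = Hom.dagger n (p + m) (g.comp (Hom.vars φ)))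
    {h : Hom A m p} (hh : h = Hom.dagger m p ((f.comp (Hom.vars φ)).comp
      ((Hom.id (p + m)).pair k))) :
    Hom.dagger (m + n) p (f.pair g) = h.pair (k.comp ((Hom.id p).pair h)) := by
  have hk' : IsDag (split (p + m) n ∘ φ) g k := by
    rw [hk]
    exact isDag_bind_vars.1 (isDag_dagger _ _ _)
  have hh' : IsDag (split p m) (fun c => bind (f c) (close (split (p + m) n ∘ φ) k)) h := by
    have e : (fun c => bind (f c) (close (split (p + m) n ∘ φ) k)) =
        (f.comp (Hom.vars φ)).comp ((Hom.id (p + m)).pair k) := by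
      rw [← close_comp_vars, close_split]
      exact (comp_assoc _ _ _).symm
    rw [hh, e]
    exact isDag_dagger _ _ _
  -- `IsDag.bekic` lists the block solved first on the left, here `g`; the flip restores the order
  -- `⟨f, g⟩`.
  have := (hk'.bekic hh').reindex ((Equiv.sumComm _ _).trans finSumFinEquiv)
  refine dagger_eq ?_
  convert this using 1
  · funext j
    induction j using Fin.addCases with
    | left j =>
      have : φ (j.castAdd (m + n)) = (j.castAdd m).castAdd n := by rw [hφ]; rfl
      simp [this]
    | right j =>
      induction j using Fin.addCases with
      | left j =>
        have : φ (Fin.natAdd p (j.castAdd n)) = (j.natAdd p).castAdd n := by rw [hφ]; rfl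
        simp [this]
      | right j =>
        have : φ (Fin.natAdd p (j.natAdd m)) = j.natAdd (p + m) := by
          rw [hφ]
          exact Fin.ext (Nat.add_assoc p m j).symm
        simp [this]
  · exact hom_ext_pair (fun i => by simp) (fun i => by simp)
  · exact hom_ext_pair (fun i => by simp) (fun i => by simp [comp_apply, close_split])

end RegBeh

/-! ### Monoidal structure -/

namespace RegBeh

variable {A : Type u}

/-- The identity `m → n` for `m = n`. -/
def cast {m n : ℕ} (h : m = n) : Hom A m n := Hom.vars (Fin.cast h)

theorem cast_apply {m n : ℕ} (h : m = n) (i : Fin m) : (cast h : Hom A m n) i = vr (i.cast h) := rfl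

theorem cast_comp_cast {m n p : ℕ} (h : m = n) (h' : n = p) :
    (cast h).comp (cast h') = (cast (h.trans h') : Hom A m p) := by
  subst h
  exact id_comp _

/-- Reassociated sums are equal but not definitionally so. Writing the structural isomorphisms as
tuples of variables makes them computable componentwise. -/
theorem eqToHom_eq {m n : ℕ} (h : m = n) :
    eqToHom (show of A m = of A n from h) = (cast h : Hom A m n) := by
  subst h
  rfl

theorem associator_hom (k l m : ℕ) :
    (α_ (of A k) (of A l) (of A m)).hom = (cast (Nat.add_assoc k l m) : Hom A _ _) :=
  eqToHom_eq (Nat.add_assoc k l m)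

theorem associator_inv (k l m : ℕ) :
    (α_ (of A k) (of A l) (of A m)).inv = (cast (Nat.add_assoc k l m).symm : Hom A _ _) :=
  eqToHom_eq (Nat.add_assoc k l m).symm

theorem leftUnitor_hom (m : ℕ) :
    (λ_ (of A m)).hom = (cast (Nat.zero_add m) : Hom A _ _) :=
  eqToHom_eq (Nat.zero_add m)

theorem leftUnitor_inv (m : ℕ) :
    (λ_ (of A m)).inv = (cast (Nat.zero_add m).symm : Hom A _ _) :=
  eqToHom_eq (Nat.zero_add m).symm

theorem rightUnitor_hom (m : ℕ) :
    (ρ_ (of A m)).hom = (cast (Nat.add_zero m) : Hom A _ _) :=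
  eqToHom_eq (Nat.add_zero m)

theorem rightUnitor_inv (m : ℕ) :
    (ρ_ (of A m)).inv = (cast (Nat.add_zero m).symm : Hom A _ _) :=
  eqToHom_eq (Nat.add_zero m).symm

/-! ### Inclusions against parallel composition and reassociation -/

theorem sum_castAdd {k l m n : ℕ} (f : Hom A k l) (g : Hom A m n) (i : Fin k) :
    f.sum g (i.castAdd m) = bind (f i) (Hom.inl l n) := by
  rw [sum_eq, pair_castAdd, comp_apply]

theorem sum_natAdd {k l m n : ℕ} (f : Hom A k l) (g : Hom A m n) (i : Fin m) :
    f.sum g (i.natAdd k) = bind (g i) (Hom.inr l n) := by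
  rw [sum_eq, pair_natAdd, comp_apply]

theorem inl_comp_sum {k l m n : ℕ} (f : Hom A k l) (g : Hom A m n) :
    (Hom.inl k m).comp (f.sum g) = f.comp (Hom.inl l n) := by
  rw [sum_eq, inl_comp_pair]

theorem inr_comp_sum {k l m n : ℕ} (f : Hom A k l) (g : Hom A m n) :
    (Hom.inr k m).comp (f.sum g) = g.comp (Hom.inr l n) := by
  rw [sum_eq, inr_comp_pair]

/-- Joint epimorphy of the inclusions; coherence laws are checked on the summands through it. -/
theorem hom_ext_inl_inr {k l m : ℕ} {f g : Hom A (k + l) m}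
    (h₁ : (Hom.inl k l).comp f = (Hom.inl k l).comp g)
    (h₂ : (Hom.inr k l).comp f = (Hom.inr k l).comp g) : f = g := by
  rw [← pair_inl_inr_comp f, h₁, h₂, pair_inl_inr_comp]

theorem sum_comp_pair {k l m n p : ℕ} (f : Hom A k l) (g : Hom A m n) (r : Hom A l p)
    (s : Hom A n p) : (f.sum g).comp (r.pair s) = (f.comp r).pair (g.comp s) := by
  rw [sum_eq, pair_comp, comp_assoc, comp_assoc, inl_comp_pair, inr_comp_pair]

theorem sum_comp_sum {k l m n p q : ℕ} (f : Hom A k l) (g : Hom A m n) (r : Hom A l p)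
    (s : Hom A n q) : (f.sum g).comp (r.sum s) = (f.comp r).sum (g.comp s) := by
  rw [sum_eq r s, sum_comp_pair, sum_eq, comp_assoc, comp_assoc]

theorem sum_id (m n : ℕ) : (Hom.id m).sum (Hom.id n) = (Hom.id (m + n) : Hom A _ _) := by
  rw [sum_eq, id_comp, id_comp]
  exact (pair_inl_inr_comp (Hom.id (m + n))).symm ▸ by rw [comp_id, comp_id]

theorem cast_sum_cast {k l m n : ℕ} (h : k = l) (h' : m = n) :
    (cast h).sum (cast h') = (cast (congrArg₂ (· + ·) h h') : Hom A (k + m) (l + n)) := by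
  subst h h'
  exact sum_id _ _

theorem inl_comp_cast (k l m : ℕ) :
    (Hom.inl (k + l) m).comp (cast (Nat.add_assoc k l m)) =
      ((Hom.id k).sum (Hom.inl l m) : Hom A _ _) := by
  refine hom_ext_pair (fun i => ?_) fun i => ?_
  · rw [comp_apply, inl_apply, bind_vr, sum_castAdd, id_apply, bind_vr, inl_apply, cast_apply]
    rfl
  · rw [comp_apply, inl_apply, bind_vr, sum_natAdd, inl_apply, bind_vr, inr_apply, cast_apply]
    rfl

theorem inr_comp_cast (k l m : ℕ) :
    (Hom.inr (k + l) m).comp (cast (Nat.add_assoc k l m)) =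
      ((Hom.inr l m).comp (Hom.inr k (l + m)) : Hom A _ _) := by
  funext i
  rw [comp_apply, inr_apply, bind_vr, comp_apply, inr_apply, bind_vr, inr_apply, cast_apply]
  exact congrArg vr (Fin.ext (Nat.add_assoc k l i))

theorem inl_comp_cast_symm (k l m : ℕ) :
    (Hom.inl k (l + m)).comp (cast (Nat.add_assoc k l m).symm) =
      ((Hom.inl k l).comp (Hom.inl (k + l) m) : Hom A _ _) := by
  funext i
  rw [comp_apply, inl_apply, bind_vr, comp_apply, inl_apply, bind_vr, inl_apply, cast_apply]
  rfl

theorem inr_comp_cast_symm (k l m : ℕ) :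
    (Hom.inr k (l + m)).comp (cast (Nat.add_assoc k l m).symm) =
      ((Hom.inr k l).sum (Hom.id m) : Hom A _ _) := by
  refine hom_ext_pair (fun i => ?_) fun i => ?_
  · rw [comp_apply, inr_apply, bind_vr, sum_castAdd, inr_apply, bind_vr, inl_apply, cast_apply]
    rfl
  · rw [comp_apply, inr_apply, bind_vr, sum_natAdd, id_apply, bind_vr, inr_apply, cast_apply]
    exact congrArg vr (Fin.ext (Nat.add_assoc k l i).symm)

theorem inl_comp_sum_assoc {k l m n : ℕ} (f : Hom A k l) (g : Hom A m n) {r : ℕ}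
    (h : Hom A (l + n) r) :
    (Hom.inl k m).comp ((f.sum g).comp h) = f.comp ((Hom.inl l n).comp h) := by
  rw [← comp_assoc, inl_comp_sum, comp_assoc]

theorem inr_comp_sum_assoc {k l m n : ℕ} (f : Hom A k l) (g : Hom A m n) {r : ℕ}
    (h : Hom A (l + n) r) :
    (Hom.inr k m).comp ((f.sum g).comp h) = g.comp ((Hom.inr l n).comp h) := by
  rw [← comp_assoc, inr_comp_sum, comp_assoc]

theorem inl_comp_cast_assoc (k l m : ℕ) {r : ℕ}
    (h : Hom A (k + (l + m)) r) :
    (Hom.inl (k + l) m).comp ((cast (Nat.add_assoc k l m)).comp h) = ((Hom.id k).sum (Hom.inl l m)).comp h := by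
  rw [← comp_assoc, inl_comp_cast]

theorem inr_comp_cast_assoc (k l m : ℕ) {r : ℕ}
    (h : Hom A (k + (l + m)) r) :
    (Hom.inr (k + l) m).comp ((cast (Nat.add_assoc k l m)).comp h) = (Hom.inr l m).comp ((Hom.inr k (l + m)).comp h) := by
  rw [← comp_assoc, inr_comp_cast, comp_assoc]

theorem inl_comp_cast_symm_assoc (k l m : ℕ) {r : ℕ}
    (h : Hom A (k + l + m) r) :
    (Hom.inl k (l + m)).comp ((cast (Nat.add_assoc k l m).symm).comp h) = (Hom.inl k l).comp ((Hom.inl (k + l) m).comp h) := by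
  rw [← comp_assoc, inl_comp_cast_symm, comp_assoc]

theorem inr_comp_cast_symm_assoc (k l m : ℕ) {r : ℕ}
    (h : Hom A (k + l + m) r) :
    (Hom.inr k (l + m)).comp ((cast (Nat.add_assoc k l m).symm).comp h) = ((Hom.inr k l).sum (Hom.id m)).comp h := by
  rw [← comp_assoc, inr_comp_cast_symm]

theorem inr_zero_left (n : ℕ) : (Hom.inr 0 n : Hom A n (0 + n)) = cast (Nat.zero_add n).symm :=
  funext fun i => congrArg vr (Fin.ext (Nat.zero_add i))

theorem sum_assoc {k l m n p q : ℕ} (f : Hom A k l) (g : Hom A m n) (h : Hom A p q) :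
    ((f.sum g).sum h).comp (cast (Nat.add_assoc l n q)) =
      (cast (Nat.add_assoc k m p)).comp (f.sum (g.sum h)) := by
  refine hom_ext_inl_inr (hom_ext_inl_inr ?_ ?_) ?_ <;>
    simp only [inl_comp_sum, inr_comp_sum, inl_comp_cast, inr_comp_cast, id_comp,
      inl_comp_sum_assoc, inr_comp_sum_assoc, inl_comp_cast_assoc, inr_comp_cast_assoc]

theorem id_sum_comp_cast {m n : ℕ} (f : Hom A m n) :
    ((Hom.id 0).sum f).comp (cast (Nat.zero_add n)) = (cast (Nat.zero_add m)).comp f := by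
  refine hom_ext_inl_inr (funext fun i => i.elim0) ?_
  rw [inr_comp_sum_assoc, ← comp_assoc (Hom.inr 0 m), inr_zero_left, inr_zero_left,
    cast_comp_cast, cast_comp_cast]
  exact (comp_id f).trans (id_comp f).symm

theorem sum_id_comp_cast {m n : ℕ} (f : Hom A m n) :
    (f.sum (Hom.id 0)).comp (cast (Nat.add_zero n)) = (cast (Nat.add_zero m)).comp f := by
  refine hom_ext_inl_inr ?_ (funext fun i => i.elim0)
  rw [inl_comp_sum_assoc]
  have h (k : ℕ) : (Hom.inl k 0).comp (cast (Nat.add_zero k)) = (Hom.id k : Hom A k k) :=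
    funext fun i => bind_vr _ _
  rw [h, comp_id, ← comp_assoc]
  exact ((congrArg (fun c => Hom.comp c f) (h m)).trans (id_comp f)).symm

/-! ### Symmetry and coherence -/

theorem swap_comp_swap (m n : ℕ) :
    (Hom.swap m n).comp (Hom.swap n m) = (Hom.id (m + n) : Hom A _ _) := by
  refine hom_ext_inl_inr ?_ ?_ <;>
    rw [Hom.swap, Hom.swap, ← comp_assoc] <;> simp

theorem sum_comp_swap {k l m n : ℕ} (f : Hom A k l) (g : Hom A m n) :
    (f.sum g).comp (Hom.swap l n) = (Hom.swap k m).comp (g.sum f) := by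
  rw [Hom.swap, Hom.swap, sum_comp_pair, pair_comp, inl_comp_sum, inr_comp_sum]

/-- The associators enter as variables with equations, so that the `eqToIso` components of the
monoidal structure can be supplied without rewriting under dependent types. -/
theorem swap_hexagon {k l m : ℕ} {a₁ : Hom A (k + l + m) (k + (l + m))}
    {a₂ : Hom A (l + m + k) (l + (m + k))} {a₃ : Hom A (l + k + m) (l + (k + m))}
    (h₁ : a₁ = cast (Nat.add_assoc _ _ _)) (h₂ : a₂ = cast (Nat.add_assoc _ _ _))
    (h₃ : a₃ = cast (Nat.add_assoc _ _ _)) :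
    a₁.comp ((Hom.swap k (l + m)).comp a₂) =
      ((Hom.swap k l).sum (Hom.id m)).comp (a₃.comp ((Hom.id l).sum (Hom.swap k m))) := by
  subst h₁ h₂ h₃
  refine hom_ext_inl_inr (hom_ext_inl_inr ?_ ?_) ?_
  all_goals
    simp only [Hom.swap, pair_comp, inl_comp_sum, inr_comp_sum, inl_comp_cast, inr_comp_cast,
      id_comp, inl_comp_pair, inr_comp_pair, inl_comp_sum_assoc, inr_comp_sum_assoc,
      inl_comp_cast_assoc, inr_comp_cast_assoc]

theorem swap_hexagon_symm {k l m : ℕ} {a₁ : Hom A (k + (l + m)) (k + l + m)}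
    {a₂ : Hom A (m + (k + l)) (m + k + l)} {a₃ : Hom A (k + (m + l)) (k + m + l)}
    (h₁ : a₁ = cast (Nat.add_assoc _ _ _).symm) (h₂ : a₂ = cast (Nat.add_assoc _ _ _).symm)
    (h₃ : a₃ = cast (Nat.add_assoc _ _ _).symm) :
    a₁.comp ((Hom.swap (k + l) m).comp a₂) =
      ((Hom.id k).sum (Hom.swap l m)).comp (a₃.comp ((Hom.swap k m).sum (Hom.id l))) := by
  subst h₁ h₂ h₃
  refine hom_ext_inl_inr ?_ (hom_ext_inl_inr ?_ ?_)
  all_goals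
    simp only [Hom.swap, pair_comp, inl_comp_sum, inr_comp_sum, inl_comp_cast_symm,
      inr_comp_cast_symm, id_comp, inl_comp_pair, inr_comp_pair, inl_comp_sum_assoc,
      inr_comp_sum_assoc, inl_comp_cast_symm_assoc, inr_comp_cast_symm_assoc]

theorem cast_pentagon {k l m n : ℕ} {a₁ : Hom A (k + l + m) (k + (l + m))}
    {a₂ : Hom A (k + (l + m) + n) (k + (l + m + n))} {a₃ : Hom A (l + m + n) (l + (m + n))}
    {a₄ : Hom A (k + l + m + n) (k + l + (m + n))} {a₅ : Hom A (k + l + (m + n)) (k + (l + (m + n)))}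
    (h₁ : a₁ = cast (Nat.add_assoc _ _ _)) (h₂ : a₂ = cast (Nat.add_assoc _ _ _))
    (h₃ : a₃ = cast (Nat.add_assoc _ _ _)) (h₄ : a₄ = cast (Nat.add_assoc _ _ _))
    (h₅ : a₅ = cast (Nat.add_assoc _ _ _)) :
    (a₁.sum (Hom.id n)).comp (a₂.comp ((Hom.id k).sum a₃)) = a₄.comp a₅ := by
  have e₁ : a₁.sum (Hom.id n) = cast (congrArg (· + n) (Nat.add_assoc k l m)) :=
    h₁ ▸ cast_sum_cast _ rfl
  have e₃ : (Hom.id k).sum a₃ = cast (congrArg (k + ·) (Nat.add_assoc l m n)) :=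
    h₃ ▸ cast_sum_cast rfl _
  rw [e₁, e₃, h₂, h₄, h₅, cast_comp_cast, cast_comp_cast, cast_comp_cast]

theorem cast_triangle {m n : ℕ} {a : Hom A (m + 0 + n) (m + (0 + n))} {b : Hom A (0 + n) n}
    {c : Hom A (m + 0) m} (ha : a = cast (Nat.add_assoc _ _ _)) (hb : b = cast (Nat.zero_add _))
    (hc : c = cast (Nat.add_zero _)) :
    a.comp ((Hom.id m).sum b) = c.sum (Hom.id n) := by
  have e₁ : (Hom.id m).sum b = cast (congrArg (m + ·) (Nat.zero_add n)) :=
    hb ▸ cast_sum_cast rfl _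
  have e₂ : c.sum (Hom.id n) = cast (congrArg (· + n) (Nat.add_zero m)) :=
    hc ▸ cast_sum_cast _ rfl
  rw [e₁, e₂, ha, cast_comp_cast]

/-- The monoidal category of regular behaviours. -/
@[reducible] noncomputable def monoidal (A : Type u) : MonoidalCategory (RegBeh A) where
  __ := monoidalStruct A
  tensorHom_def f g := by
    refine Eq.trans ?_ (sum_comp_sum _ _ _ _).symm
    exact (congrArg₂ Hom.sum (comp_id f) (id_comp g)).symm
  id_tensorHom_id m n := sum_id m n
  tensorHom_comp_tensorHom f g h k := sum_comp_sum f g h k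
  whiskerLeft_id m n := sum_id m n
  id_whiskerRight m n := sum_id m n
  associator_naturality f g h :=
    (congrArg _ (associator_hom _ _ _)).trans ((sum_assoc f g h).trans
      (congrArg (fun c => Hom.comp c _) (associator_hom _ _ _).symm))
  leftUnitor_naturality {m n} f := by
    refine (congrArg _ (leftUnitor_hom n)).trans
      (Eq.trans ?_ (congrArg (fun c => Hom.comp c f) (leftUnitor_hom m).symm))
    exact id_sum_comp_cast f
  rightUnitor_naturality {m n} f := by
    refine (congrArg _ (rightUnitor_hom n)).trans
      (Eq.trans ?_ (congrArg (fun c => Hom.comp c f) (rightUnitor_hom m).symm))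
    exact sum_id_comp_cast f
  pentagon k l m n := cast_pentagon (associator_hom k l m) (associator_hom k (Nat.add l m) n)
    (associator_hom l m n) (associator_hom (Nat.add k l) m n) (associator_hom k l (Nat.add m n))
  triangle m n := cast_triangle (associator_hom m (of A 0) n) (leftUnitor_hom n) (rightUnitor_hom m)

/-- The symmetry of the monoidal category of regular behaviours. -/
@[reducible] noncomputable def symmetric (A : Type u) :
    @SymmetricCategory (RegBeh A) _ (monoidal A) :=
  letI := monoidal A
  { braiding := fun m n => ⟨Hom.swap (A := A) m n, Hom.swap (A := A) n m, swap_comp_swap m n, swap_comp_swap n m⟩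
    braiding_naturality_right := fun m _ _ f => sum_comp_swap (Hom.id m) f
    braiding_naturality_left := fun f m => sum_comp_swap f (Hom.id m)
    hexagon_forward := fun k l m =>
      swap_hexagon (associator_hom k l m) (associator_hom l m k) (associator_hom l k m)
    hexagon_reverse := fun k l m =>
      swap_hexagon_symm (associator_inv k l m) (associator_inv m k l) (associator_inv k m l)
    symmetry := fun m n => swap_comp_swap m n }

theorem isSymmetricMonoidal : IsSymmetricMonoidal (RegBeh A) (fun m n => Hom.swap m n) :=
  ⟨monoidal A, symmetric A, rfl, fun _ _ => HEq.rfl⟩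

theorem isStrictMonoidal : IsStrictMonoidal (RegBeh A) where
  associator k l m := ⟨Nat.add_assoc k l m, rfl⟩
  leftUnitor m := ⟨Nat.zero_add m, rfl⟩
  rightUnitor m := ⟨Nat.add_zero m, rfl⟩

/-! ### Coproducts -/

/-- The object `0` is initial. -/
noncomputable def isInitial (A : Type u) : IsInitial (of A 0) :=
  IsInitial.ofUniqueHom (fun n => Hom.zero n) fun _ f => zero_eq f

/-- The object `k + l` is a coproduct of `k` and `l`. -/
noncomputable def isColimit (A : Type u) (k l : ℕ) :
    IsColimit (BinaryCofan.mk (X := of A k) (Y := of A l) (P := of A (k + l))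
      (Hom.inl k l) (Hom.inr k l)) :=
  BinaryCofan.isColimitMk (fun s => Hom.pair s.inl s.inr)
    (fun _ => inl_comp_pair _ _) (fun _ => inr_comp_pair _ _) fun _ f h₁ h₂ =>
      (pair_inl_inr_comp f).symm.trans (congrArg₂ Hom.pair h₁ h₂)

theorem hasFiniteCoproducts : HasFiniteCoproducts (RegBeh A) := by
  have : HasInitial (RegBeh A) := (isInitial A).hasInitial
  have (k l : RegBeh A) : HasColimit (Limits.pair k l) := ⟨⟨_, isColimit A k l⟩⟩
  have : HasBinaryCoproducts (RegBeh A) := hasBinaryCoproducts_of_hasColimit_pair _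
  exact hasFiniteCoproducts_of_has_binary_and_initial

theorem isCocartesianMonoidal : IsCocartesianMonoidal (RegBeh A) := by
  refine ⟨isInitial A, fun k l => ⟨?_⟩⟩
  have h₁ : (ρ_ k).inv ≫ k ◁ (isInitial A).to l = Hom.inl k l := by
    refine (congrArg (fun c => Hom.comp c _) (rightUnitor_inv k)).trans (funext fun i => ?_)
    refine (bind_vr _ _).trans ((sum_castAdd (Hom.id k) _ i).trans ?_)
    exact bind_vr _ _
  have h₂ : (λ_ l).inv ≫ (isInitial A).to k ▷ l = Hom.inr k l := by
    refine (congrArg (fun c => Hom.comp c _)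
      ((leftUnitor_inv l).trans (inr_zero_left l).symm)).trans ?_
    exact (inr_comp_sum _ (Hom.id l)).trans (id_comp _)
  rw [h₁, h₂]
  exact isColimit A k l

end RegBeh

/-! ### Axioms of a trace -/

namespace RegBeh

variable {A : Type u}

theorem trace_naturality_left {m m' n p : ℕ} (h : Hom A m' m) (f : Hom A (m + p) (n + p)) :
    Hom.trace m' n p ((h.sum (Hom.id p)).comp f) = h.comp (Hom.trace m n p f) := by
  rw [trace_eq, trace_eq, inl_comp_sum_assoc, inr_comp_sum_assoc, id_comp, comp_assoc,
    comp_assoc]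

theorem trace_naturality_right {m n n' p : ℕ} (f : Hom A (m + p) (n + p)) (k : Hom A n n') :
    Hom.trace m n' p (f.comp (k.sum (Hom.id p))) = (Hom.trace m n p f).comp k := by
  rw [trace_eq, trace_eq, ← comp_assoc (Hom.inr m p), dagger_parameter, comp_assoc, comp_assoc,
    comp_assoc, comp_assoc, sum_id_comp_pair, pair_comp, id_comp, comp_id]

/-- Dinaturality of the dagger. -/
theorem dagger_dinatural {m n p : ℕ} (f : Hom A n (p + m)) (k : Hom A m n) :
    Hom.dagger m p (k.comp f) =
      k.comp (Hom.dagger n p (f.comp ((Hom.id p).sum k))) := by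
  -- Composition identity with first morphism `k ; inr`, which ignores the parameters: `k ; inr ;
  -- ⟨inl, f⟩` is `k ; f`.
  have := dagger_composition (k.comp (Hom.inr p n)) f
  rw [comp_assoc, comp_assoc, inr_comp_pair, inr_comp_pair] at this
  rw [this, sum_eq, id_comp]

theorem trace_sliding {m n p p' : ℕ} (f : Hom A (m + p) (n + p')) (k : Hom A p' p) :
    Hom.trace m n p (f.comp ((Hom.id n).sum k)) =
      Hom.trace m n p' (((Hom.id m).sum k).comp f) := by
  rw [trace_eq, trace_eq, inl_comp_sum_assoc, inr_comp_sum_assoc, id_comp,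
    dagger_dinatural ((Hom.inr m p).comp f) k, comp_assoc, comp_assoc, comp_assoc, sum_comp_pair,
    id_comp, comp_assoc]

theorem trace_vanishing_zero {m n : ℕ} (f : Hom A (m + 0) (n + 0)) :
    Hom.trace m n 0 f = (cast (Nat.add_zero m).symm).comp (f.comp (cast (Nat.add_zero n))) := by
  have h : (Hom.id n).pair (Hom.zero n) = (cast (Nat.add_zero n) : Hom A (n + 0) n) :=
    hom_ext_pair (fun i => pair_castAdd _ _ i) fun i => i.elim0
  rw [trace_eq, zero_eq (Hom.dagger _ _ _), h]
  exact comp_assoc _ _ _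

/-- Bekić's identity in trace form: the inner trace solves the block `p'`, the outer one the block
`p`. -/
theorem trace_vanishing_add {m n p p' : ℕ} (f : Hom A (m + (p + p')) (n + (p + p'))) :
    Hom.trace m n (p + p') f = Hom.trace m n p (Hom.trace (m + p) (n + p) p'
      ((cast (Nat.add_assoc m p p')).comp (f.comp (cast (Nat.add_assoc n p p').symm)))) := by
  set c : Hom A (n + (p + p')) (n + p + p') := cast (Nat.add_assoc n p p').symm with hc
  set k := Hom.dagger p' (n + p) (((Hom.inr p p').comp ((Hom.inr m (p + p')).comp f)).comp c)
    with hk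
  set h := Hom.dagger p n ((((Hom.inl p p').comp ((Hom.inr m (p + p')).comp f)).comp c).comp
    ((Hom.id (n + p)).pair k)) with hh
  have hd := dagger_pair ((Hom.inl p p').comp ((Hom.inr m (p + p')).comp f))
    ((Hom.inr p p').comp ((Hom.inr m (p + p')).comp f)) rfl hk hh
  rw [pair_inl_inr_comp] at hd
  -- Closing the two blocks one after the other is closing with the joint solution given by `hd`.
  have hcc : c.comp (((Hom.id (n + p)).pair k).comp ((Hom.id n).pair h)) =
      (Hom.id n).pair (h.pair (k.comp ((Hom.id n).pair h))) := by
    refine hom_ext_inl_inr ?_ (hom_ext_inl_inr ?_ ?_) <;>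
      simp only [hc, pair_comp, id_comp, inl_comp_cast_symm_assoc, inr_comp_cast_symm_assoc,
        inl_comp_pair, inr_comp_pair, inl_comp_sum_assoc, inr_comp_sum_assoc]
  have h₂ : (Hom.inr (m + p) p').comp
      ((cast (Nat.add_assoc m p p')).comp (f.comp c)) =
      ((Hom.inr p p').comp ((Hom.inr m (p + p')).comp f)).comp c := by
    rw [inr_comp_cast_assoc, comp_assoc, comp_assoc]
  rw [trace_eq, hd, trace_eq (n := p'), h₂, ← hk, inl_comp_cast_assoc, trace_eq]
  have h₃ : (Hom.inr m p).comp ((((Hom.id m).sum (Hom.inl p p')).comp (f.comp c)).comp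
      ((Hom.id (n + p)).pair k)) = (((Hom.inl p p').comp ((Hom.inr m (p + p')).comp f)).comp
      c).comp ((Hom.id (n + p)).pair k) := by
    rw [comp_assoc, inr_comp_sum_assoc, comp_assoc, comp_assoc, comp_assoc, comp_assoc]
  rw [h₃, ← hh, comp_assoc ((Hom.id m).sum _), inl_comp_sum_assoc, id_comp, comp_assoc,
    comp_assoc, comp_assoc, comp_assoc, hcc]

/-- The feedback part is that of `f` with its parameters shifted past `l`, so the parameter identity
applied to `inr` moves the shift outside the dagger. -/
theorem trace_superposing {k l m n p : ℕ} (g : Hom A k l) (f : Hom A (m + p) (n + p)) :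
    Hom.trace (k + m) (l + n) p ((cast (Nat.add_assoc k m p)).comp
      ((g.sum f).comp (cast (Nat.add_assoc l n p).symm))) = g.sum (Hom.trace m n p f) := by
  have h : (Hom.inr (k + m) p).comp ((cast (Nat.add_assoc k m p)).comp
      ((g.sum f).comp (cast (Nat.add_assoc l n p).symm))) =
      ((Hom.inr m p).comp f).comp ((Hom.inr l n).sum (Hom.id p)) := by
    rw [inr_comp_cast_assoc, inr_comp_sum_assoc, inr_comp_cast_symm, comp_assoc]
  rw [trace_eq, h, dagger_parameter, inl_comp_cast_assoc, trace_eq]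
  refine hom_ext_inl_inr ?_ ?_
  · rw [comp_assoc, inl_comp_sum_assoc, id_comp, comp_assoc, inl_comp_sum_assoc, comp_assoc,
      inl_comp_cast_symm_assoc, inl_comp_pair, comp_id, inl_comp_sum]
  · rw [comp_assoc, inr_comp_sum_assoc, comp_assoc, inr_comp_sum_assoc, comp_assoc,
      inr_comp_cast_symm_assoc, sum_id_comp_pair, comp_id, inr_comp_sum, comp_assoc, comp_assoc,
      pair_comp, id_comp]

/-- By `trace_eq` the trace of the symmetry is the dagger of `inl`. No recursion variable occurs
there, so one use of the fixed point identity gives the identity. -/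
theorem trace_yanking (n : ℕ) : Hom.trace n n n (Hom.swap n n) = (Hom.id n : Hom A n n) := by
  rw [trace_eq, Hom.swap, inl_comp_pair, inr_comp_pair, inr_comp_pair, dagger_fixed,
    inl_comp_pair]

theorem isTrace_trace : IsTrace (C := RegBeh A) (fun m n => Hom.swap m n)
    (fun p q n g => Hom.trace p q n g) where
  naturality_left h f := trace_naturality_left h f
  naturality_right f k := trace_naturality_right f k
  sliding f k := trace_sliding f k
  vanishing_unit {m n} f := by
    refine (trace_vanishing_zero f).trans ?_
    exact congrArg₂ (fun a b => Hom.comp a (Hom.comp f b)) (rightUnitor_inv m).symm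
      (rightUnitor_hom n).symm
  vanishing_tensor {m n p p'} f := by
    refine (trace_vanishing_add f).trans ?_
    exact congrArg₂ (fun a b => Hom.trace m n p (Hom.trace (Nat.add m p) (Nat.add n p) p'
      (Hom.comp a (Hom.comp f b)))) (associator_hom m p p').symm (associator_inv n p p').symm
  superposing {m n k l p} g f := by
    refine Eq.trans ?_ (trace_superposing g f)
    exact congrArg₂ (fun a b => Hom.trace (Nat.add k m) (Nat.add l n) p
      (Hom.comp a (Hom.comp (Hom.sum g f) b))) (associator_hom k m p) (associator_inv l n p)
  yanking n := trace_yanking n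

end RegBeh

theorem mainTheorem5 (A : Type u) :
    -- finite coproducts, given by addition of natural numbers, inclusions and pairing
    (HasFiniteCoproducts (RegBeh A) ∧
      Nonempty (IsInitial (RegBeh.of A 0)) ∧
      ∀ k l : ℕ, ∃ hc : IsColimit (BinaryCofan.mk (X := RegBeh.of A k) (Y := RegBeh.of A l)
          (P := RegBeh.of A (k + l)) (RegBeh.Hom.inl k l) (RegBeh.Hom.inr k l)),
        ∀ (m : ℕ) (f : RegBeh.Hom A k m) (g : RegBeh.Hom A l m),
          hc.desc (BinaryCofan.mk (X := RegBeh.of A k) (Y := RegBeh.of A l)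
            (P := RegBeh.of A m) f g) = f.pair g) ∧
    -- co-Cartesian strict symmetric monoidal category
    (IsSymmetricMonoidal (RegBeh A) (fun m n => RegBeh.Hom.swap m n) ∧
      IsStrictMonoidal (RegBeh A) ∧
      IsCocartesianMonoidal (RegBeh A)) ∧
    -- Conway theory, with `f† = μ v_{p+1}. f` for `f : 1 → p + 1`
    ((∀ (p : ℕ) (f : RegBeh.Hom A 1 (p + 1)), RegBeh.Hom.dagger 1 p f = f.mu) ∧
      RegBeh.IsConway (A := A) RegBeh.Hom.dagger) ∧
    -- traced monoidal category, with the trace defined from the dagger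
    IsTrace (C := RegBeh A) (fun m n => RegBeh.Hom.swap m n)
      (fun p q n g => RegBeh.Hom.trace p q n g) := by
  exact ⟨⟨RegBeh.hasFiniteCoproducts, ⟨RegBeh.isInitial A⟩,
      fun k l => ⟨RegBeh.isColimit A k l, fun _ _ _ => rfl⟩⟩,
    ⟨RegBeh.isSymmetricMonoidal, RegBeh.isStrictMonoidal, RegBeh.isCocartesianMonoidal⟩,
    ⟨fun _ f => RegBeh.dagger_one f, RegBeh.isConway_dagger⟩, RegBeh.isTrace_trace⟩
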